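/- Let $(\Omega,\rho_\Omega)$ be a complete separable metric space with its Borel $\sigma$-algebra, $\mu$ a Borel probability measure on $\Omega$, $t_0<T$, $\mathbb B$ the open unit ball of $\mathbb R^n$, and $L^2:=L^2(\mu,\Omega;\mathbb R^n)$ with its scalar product $\langle\cdot,\cdot\rangle$. Let $f_0,\dots,f_m:\mathbb R^n\times\Omega\to\mathbb R^n$ (with $f_i(x,\cdot)$ measurable), $g:\mathbb R^n\times\Omega\to\mathbb R$, $\varphi\in L^2$, and let $U(t)\subset\mathbb R^m$, $t\in[t_0,T]$, be non-empty closed sets contained in a common compact set. Put $f(x,u,\omega)=f_0(x,\omega)+\sum_{i=1}^m u_i f_i(x,\omega)$, and for $\psi\in L^2$, $u\in\mathbb R^m$ let $f(\psi,u):=f(\psi(\cdot),u,\cdot)\in L^2$. An admissible process is a pair $(x,u)$ with $u\in L^\infty(t_0,T;\mathbb R^m)$, $u(t)\in U(t)$ for a.e. $t$, and, for every $\omega\in\Omega$, $x(\cdot,\omega)\in W^{1,1}([t_0,T];\mathbb R^n)$ with $x(t,\omega)=\varphi(\omega)+\int_{t_0}^t f(x(s,\omega),u(s),\omega)\,ds$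 on $[t_0,T]$; we write $x(t)=x(t,\cdot)\in L^2$. An admissible process $(\bar x,\bar u)$ is a $W^{1,1}$-local minimizer if there is $\epsilon>0$ such that $\int_\Omega g(\bar x(T,\omega),\omega)\,d\mu\le\int_\Omega g(x(T,\omega),\omega)\,d\mu$ for all admissible processes $(x,u)$ with $\|\bar x-x\|_{W^{1,1}([t_0,T];L^2)}\le\epsilon$, where $\|y\|_{W^{1,1}}=\|y\|_1+\|\dot y\|_1$. Assume (H0): $U(t)$ is convex for a.e. $t$ and the graph of $U$ is $\mathcal L\times\mathcal B^m$-measurable; for each $i$ there are $c_i,k_i>0$ with $|f_i(x,\omega)|\le c_i(1+|x|)$ and $|f_i(x,\omega)-f_i(x',\omega)|\le k_i|x-x'|$ for all $x,x',\omega$; $g$ is Borel measurable, bounded, and Lipschitz in $x$ uniformly in $\omega$. Let $(\bar x,\bar u)$ be a $W^{1,1}$-local minimizer and assume (H1): for some $\delta>0$, (i) there is a modulus of continuity $\theta_f$ (non-decreasing $[0,\infty)\to[0,\infty)$ with limit $0$ at $0^+$) such that $\int_{t_0}^T\sup_{x\in\bar x(t,\omega)+\delta\mathbb B,\,u\in U(t)}|f(x,u,\omega_1)-f(x,u,\omega_2)|\,dt\le\theta_f(\rho_\Omega(\omega_1,\omega_2))$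 for all $\omega,\omega_1,\omega_2$; (ii) for every $\omega$, $g(\cdot,\omega)$ is differentiable with continuous gradient on $\bar x(T,\omega)+\delta\mathbb B$; for every $x$, $\nabla_xg(x,\cdot)$ is continuous on $\{\omega: x\in\bar x(T,\omega)+\delta\mathbb B\}$; and $\sup_\omega|\nabla_xg(\bar x(T,\omega),\omega)|<\infty$; (iii) for every $\omega$, a.e. $t$ and all $u\in U(t)$, $f(\cdot,u,\omega)$ is $C^1$ on $\bar x(t,\omega)+\delta\mathbb B$; and $\omega\mapsto\nabla_xf(x,u,\omega)$ is continuous, uniformly in $(t,x,u)$ with $u\in U(t)$ and $x$ in these balls; (iv) for every $i$ and $\omega$ and a.e. $t$, $f_i(\cdot,\omega)$ is $C^2$ on $\bar x(t,\omega)+\delta\mathbb B$, and its first and second derivatives at $\bar x(t,\omega)$ are bounded by a constant for $\omega\in\operatorname{supp}\mu$ and a.e. $t$. Let $A(t)=\frac{\partial f}{\partial x}(\bar x(t),\bar u(t))$ be the bounded operator $\psi\mapsto\nabla_xf(\bar x(t,\cdot),\bar u(t),\cdot)\,\psi(\cdot)$ on $L^2$, and $q:=\nabla_xg(\bar x(T,\cdot),\cdot)\in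 L^2$. Then the linearized system has an evolution operator $G(s,t)$, $t_0\le t\le s\le T$, that is, $G(t,t)=I$ and $\partial_sG(s,t)=A(s)G(s,t)$ (in the strong sense: $G(s,t)\psi=\psi+\int_t^sA(r)G(r,t)\psi\,dr$ for all $\psi\in L^2$), and the function $p(t):=-G^*(T,t)q$ belongs to $W^{1,1}([t_0,T];L^2)$, is the unique solution in this space of the backward problem $$-\dot p(t)=A(t)^*p(t)\ \text{ for a.e. } t\in[t_0,T],\qquad -p(T)=q,$$ and satisfies $$\langle p(t),f(\bar x(t),\bar u(t))\rangle=\max_{u\in U(t)}\langle p(t),f(\bar x(t),u)\rangle\quad\text{for a.e. }t\in[t_0,T].$$ -/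

import Mathlib

open MeasureTheory Set Filter Topology
open scoped ENNReal

namespace EnsemblePMP

noncomputable section

/-- `ℝⁿ` with its Euclidean norm. -/
abbrev Vec (n : ℕ) : Type := EuclideanSpace ℝ (Fin n)

/-- `x` is (the continuous representative of) an element of `W^{1,1}([a,b]; X)` and `x'` is its
derivative: `x'` is Bochner integrable on `[a,b]` and `x` is a primitive of `x'` there. -/
def HasW11Deriv {X : Type*} [NormedAddCommGroup X] [NormedSpace ℝ X]
    (a b : ℝ) (x x' : ℝ → X) : Prop :=
  IntervalIntegrable x' volume a b ∧ ∀ t ∈ Icc a b, x t = x a + ∫ s in a..t, x' s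

/-- The norm `‖x‖₁ + ‖x'‖₁` of `W^{1,1}([a,b]; X)`, for `x` with derivative `x'`. -/
def w11Norm {X : Type*} [NormedAddCommGroup X] (a b : ℝ) (x x' : ℝ → X) : ℝ :=
  (∫ t in a..b, ‖x t‖) + ∫ t in a..b, ‖x' t‖

open Classical in
/-- The class in `L^p(μ, Ω; F)` of a function `φ : Ω → F` in `𝓛^p` (and `0` otherwise). -/
def toLpClass {Ω F : Type*} [MeasurableSpace Ω] [NormedAddCommGroup F]
    (p : ℝ≥0∞) (μ : Measure Ω) (φ : Ω → F) : Lp F p μ :=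
  if h : MemLp φ p μ then h.toLp φ else 0

section Dynamics

variable {Ω : Type*} {n m : ℕ}

/-- The control-affine dynamics `f(x,u,ω) = f₀(x,ω) + ∑ᵢ uᵢ fᵢ(x,ω)`. -/
def dyn (f : Fin (m + 1) → Vec n → Ω → Vec n) (x : Vec n) (u : Vec m) (ω : Ω) : Vec n :=
  f 0 x ω + ∑ i : Fin m, u i • f i.succ x ω

/-- The Jacobian `∂f/∂x (x,u,ω)` of the dynamics. -/
def dynJac (f : Fin (m + 1) → Vec n → Ω → Vec n) (x : Vec n) (u : Vec m) (ω : Ω) :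
    Vec n →L[ℝ] Vec n :=
  fderiv ℝ (fun y => dyn f y u ω) x

/-- Admissible processes: `u ∈ L^∞` with `u(t) ∈ U(t)` a.e., and for every `ω` the arc `x(·,ω)`
is a `W^{1,1}` solution of `ẋ = f(x,u,ω)`, `x(t₀,ω) = φ(ω)`, i.e. of the integral equation. -/
structure IsAdmissible (f : Fin (m + 1) → Vec n → Ω → Vec n) (U : ℝ → Set (Vec m))
    (φ : Ω → Vec n) (t₀ T : ℝ) (u : ℝ → Vec m) (x : ℝ → Ω → Vec n) : Prop where
  control_memLp : MemLp u ∞ (volume.restrict (Icc t₀ T))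
  control_mem : ∀ᵐ t ∂volume.restrict (Icc t₀ T), u t ∈ U t
  init : ∀ ω, x t₀ ω = φ ω
  arc : ∀ ω, HasW11Deriv t₀ T (fun t => x t ω) (fun t => dyn f (x t ω) (u t) ω)

variable [MeasurableSpace Ω]

/-- The dynamics as a map into `L²(μ, Ω; ℝⁿ)`: `f(φ,u) = f(φ(·),u,·)`. -/
def dynL2 (μ : Measure Ω) (f : Fin (m + 1) → Vec n → Ω → Vec n) (φ : Ω → Vec n) (u : Vec m) :
    Lp (Vec n) 2 μ :=
  toLpClass 2 μ (fun ω => dyn f (φ ω) u ω)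

/-- The operator `∂f/∂x (φ,u)` on `L²(μ, Ω; ℝⁿ)`: the multiplication operator
`ψ ↦ (∂f/∂x (φ(·),u,·)) ψ(·)` by the (essentially bounded) Jacobian. -/
def linOp (μ : Measure Ω) (f : Fin (m + 1) → Vec n → Ω → Vec n) (φ : Ω → Vec n) (u : Vec m) :
    Lp (Vec n) 2 μ →L[ℝ] Lp (Vec n) 2 μ :=
  (ContinuousLinearMap.id ℝ (Vec n →L[ℝ] Vec n)).holderL μ ∞ 2 2
    (toLpClass ∞ μ (fun ω => dynJac f (φ ω) u ω))

/-- `W^{1,1}`-local minimizers of `J = ∫ g(x(T,ω),ω) dμ(ω)`, the state being regarded as the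
`L²(μ, Ω; ℝⁿ)`-valued arc `t ↦ x(t,·)`: the process is admissible, and its cost is minimal among
the admissible processes whose state is `ε`-close to its own in `W^{1,1}([t₀,T]; L²(μ,Ω;ℝⁿ))`. -/
def IsW11LocalMinimizer (μ : Measure Ω) (f : Fin (m + 1) → Vec n → Ω → Vec n)
    (g : Vec n → Ω → ℝ) (U : ℝ → Set (Vec m)) (φ : Ω → Vec n) (t₀ T : ℝ)
    (u : ℝ → Vec m) (x : ℝ → Ω → Vec n) : Prop :=
  IsAdmissible f U φ t₀ T u x ∧
  ∃ ε > 0, ∀ (v : ℝ → Vec m) (y : ℝ → Ω → Vec n), IsAdmissible f U φ t₀ T v y →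
    ∀ d : ℝ → Lp (Vec n) 2 μ,
      HasW11Deriv t₀ T (fun t => toLpClass 2 μ (x t) - toLpClass 2 μ (y t)) d →
      w11Norm t₀ T (fun t => toLpClass 2 μ (x t) - toLpClass 2 μ (y t)) d ≤ ε →
      ∫ ω, g (x T ω) ω ∂μ ≤ ∫ ω, g (y T ω) ω ∂μ

/-- The standing assumptions (H0). -/
structure H0 (f : Fin (m + 1) → Vec n → Ω → Vec n)
    (g : Vec n → Ω → ℝ) (U : ℝ → Set (Vec m)) (t₀ T : ℝ) : Prop where
  U_nonempty : ∀ t ∈ Icc t₀ T, (U t).Nonempty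
  U_closed : ∀ t ∈ Icc t₀ T, IsClosed (U t)
  U_bounded : ∃ K : Set (Vec m), IsCompact K ∧ ∀ t ∈ Icc t₀ T, U t ⊆ K
  U_convex : ∀ᵐ t ∂volume.restrict (Icc t₀ T), Convex ℝ (U t)
  /-- The graph of `U` is measurable for (Lebesgue σ-algebra) × (Borel σ-algebra). -/
  U_graph : MeasurableSet
    {z : NullMeasurableSpace ℝ (volume : Measure ℝ) × Vec m | z.1 ∈ Icc t₀ T ∧ z.2 ∈ U z.1}
  f_measurable : ∀ i x, Measurable (f i x)
  f_growth : ∀ i, ∃ c > 0, ∀ x ω, ‖f i x ω‖ ≤ c * (1 + ‖x‖)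
  f_lipschitz : ∀ i, ∃ k > 0, ∀ x x' ω, ‖f i x ω - f i x' ω‖ ≤ k * ‖x - x'‖
  g_measurable : Measurable (fun z : Vec n × Ω => g z.1 z.2)
  g_bounded : ∃ M > 0, ∀ x ω, |g x ω| ≤ M
  g_lipschitz : ∃ k ≥ (1 : ℝ), ∀ x x' ω, |g x ω - g x' ω| ≤ k * ‖x - x'‖

/-- The regularity assumptions (H1) along the reference arc `x`, with radius `δ`. Gradients and
Jacobians are only evaluated in the tube of radius `δ` around the reference arc. -/
structure H1 [PseudoMetricSpace Ω] (μ : Measure Ω) (f : Fin (m + 1) → Vec n → Ω → Vec n)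
    (g : Vec n → Ω → ℝ) (U : ℝ → Set (Vec m)) (t₀ T : ℝ) (x : ℝ → Ω → Vec n) (δ : ℝ) :
    Prop where
  f_modulus : ∃ θ : ℝ → ℝ, (∀ s, 0 ≤ s → 0 ≤ θ s) ∧ MonotoneOn θ (Ici 0) ∧
    Tendsto θ (𝓝[>] 0) (𝓝 0) ∧
    ∀ ω ω₁ ω₂ : Ω, ∫⁻ t in Icc t₀ T,
        (⨆ y ∈ Metric.ball (x t ω) δ, ⨆ u ∈ U t, ‖dyn f y u ω₁ - dyn f y u ω₂‖ₑ)
      ≤ ENNReal.ofReal (θ (dist ω₁ ω₂))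
  g_diff : ∀ ω, ∀ y ∈ Metric.ball (x T ω) δ, DifferentiableAt ℝ (fun z => g z ω) y
  g_grad_cont : ∀ ω, ContinuousOn (gradient (fun z => g z ω)) (Metric.ball (x T ω) δ)
  g_grad_cont_param : ∀ y, ContinuousOn (fun ω => gradient (fun z => g z ω) y)
    {ω | y ∈ Metric.ball (x T ω) δ}
  g_grad_bounded : ∃ C > 0, ∀ ω, ‖gradient (fun z => g z ω) (x T ω)‖ ≤ C
  f_contDiff : ∀ ω, ∀ᵐ t ∂volume.restrict (Icc t₀ T), ∀ u ∈ U t,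
    ContDiffOn ℝ 1 (fun y => dyn f y u ω) (Metric.ball (x t ω) δ)
  f_jac_cont_param : ∀ ω₀, ∀ η > 0, ∃ r > 0, ∀ ω, dist ω ω₀ < r →
    ∀ᵐ t ∂volume.restrict (Icc t₀ T), ∀ u ∈ U t,
      ∀ y ∈ Metric.ball (x t ω₀) δ ∩ Metric.ball (x t ω) δ,
        ‖dynJac f y u ω - dynJac f y u ω₀‖ ≤ η
  fi_contDiff : ∀ i ω, ∀ᵐ t ∂volume.restrict (Icc t₀ T),
    ContDiffOn ℝ 2 (fun y => f i y ω) (Metric.ball (x t ω) δ)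
  fi_bounded : ∀ i, ∀ k ∈ ({1, 2} : Set ℕ), ∃ C > 0, ∀ ω ∈ μ.support,
    ∀ᵐ t ∂volume.restrict (Icc t₀ T), ‖iteratedFDeriv ℝ k (fun y => f i y ω) (x t ω)‖ < C

end Dynamics

/-- `G` is the evolution operator of `ẇ = A(s) w` on `[t₀,T]`: `G(t,t) = I` and
`∂G/∂s (s,t) = A(s) G(s,t)` for `t₀ ≤ t ≤ s ≤ T`, in the strong sense (applied to each vector). -/
def IsEvolutionOperator {H : Type*} [NormedAddCommGroup H] [NormedSpace ℝ H]
    (A : ℝ → H →L[ℝ] H) (t₀ T : ℝ) (G : ℝ → ℝ → H →L[ℝ] H) : Prop :=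
  ∀ t ∈ Icc t₀ T, G t t = ContinuousLinearMap.id ℝ H ∧
    ∀ ψ : H, HasW11Deriv t T (fun s => G s t ψ) (fun s => A s (G s t ψ))

end

end EnsemblePMP

/-! Idea of the proof. Let `w` be a measurable selection of `U`. By convexity the controls `u + ε (w
- u)` are admissible, and Grönwall's inequality puts their ensembles of trajectories within `O(ε)`
of the reference one in `W^{1,1}` with values in `L²`, so minimality applies for small `ε`. Because
the dynamics are affine in the control, the difference quotients of the state converge, for each
parameter separately, to the solution `y` of the linearised equation with source `f(x,w) - f(x,u)`
and zero initial value (`IsLipDyn.tendsto_variation`). All bounds are multiples of `1 + ‖φ ω‖`,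
which is square integrable, so dominated convergence passes to the cost and gives `0 ≤ ⟨q, y(T)⟩`
(`IsW11LocalMinimizer.inner_gradient_nonneg`). No differentiability of the dynamics as a map on `L²`
is needed: the limit is taken parameter by parameter and only then integrated.

In `L²` the same `y` is an arc driven by the operators `A(t)`. The product rule for `⟨p, y⟩` cancels
`A` against its adjoint and leaves `∫ ⟨p, f(x,w) - f(x,u)⟩ ≤ 0` for every selection `w`
(`IsW11LocalMinimizer.integral_inner_le_zero`). To localise in time, the integrand is written as a
sum of `m` scalar functions of `t` weighted by the coordinates of `w - u`. If the inequality failed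
on a non-null set of times, a measurable selection of violating values could be spliced into `u`
over a non-null compact set, contradicting the integrated inequality (`ae_forall_sum_mul_le_zero`).
The selection rests on the analyticity of Borel sets and on least points in the fibres over a
compact set.

The evolution operator comes from a global Picard theorem under Carathéodory hypotheses, used in
`ℝⁿ` for trajectories and in `L²` for the linear equations. Nothing is known directly about how
`G(T,t)` varies with `t`, so the adjoint arc is built by solving the backward equation, and duality
(`HasW11Deriv.eq_adjoint_apply`) identifies it with `-G*(T,t) q`. The same identity gives
uniqueness. Passing from functions of `(t, ω)` to strongly measurable `L²`-valued curves uses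
separability of `L²` and Fubini's theorem. -/

namespace EnsemblePMP

/-! ### Arcs of class `W^{1,1}` -/

section Arcs

variable {X : Type*} [NormedAddCommGroup X] [NormedSpace ℝ X] {a b : ℝ} {w w' : ℝ → X}

theorem HasW11Deriv.intervalIntegrable (h : HasW11Deriv a b w w') {s t : ℝ} (hs : s ∈ Icc a b)
    (ht : t ∈ Icc a b) : IntervalIntegrable w' volume s t :=
  h.1.mono_set (uIcc_subset_uIcc (Icc_subset_uIcc hs) (Icc_subset_uIcc ht))

theorem HasW11Deriv.sub_eq (h : HasW11Deriv a b w w') {s t : ℝ} (hs : s ∈ Icc a b)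
    (ht : t ∈ Icc a b) : w t - w s = ∫ r in s..t, w' r := by
  have ha : a ∈ Icc a b := ⟨le_rfl, hs.1.trans hs.2⟩
  rw [h.2 t ht, h.2 s hs, add_sub_add_left_eq_sub,
    intervalIntegral.integral_interval_sub_left (h.intervalIntegrable ha ht)
      (h.intervalIntegrable ha hs)]

theorem HasW11Deriv.continuousOn (h : HasW11Deriv a b w w') : ContinuousOn w (Icc a b) := by
  rcases le_or_gt a b with hab | hab
  · have h1 : ContinuousOn (fun t => w a + ∫ s in a..t, w' s) (Icc a b) := by
      have := intervalIntegral.continuousOn_primitive_interval' h.1 left_mem_uIcc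
      rw [uIcc_of_le hab] at this
      exact continuousOn_const.add this
    exact h1.congr h.2
  · simp [Icc_eq_empty_of_lt hab]

theorem HasW11Deriv.mono (h : HasW11Deriv a b w w') {c d : ℝ} (hc : c ∈ Icc a b)
    (hd : d ∈ Icc a b) : HasW11Deriv c d w w' :=
  ⟨h.intervalIntegrable hc hd, fun t ht => by
    rw [← h.sub_eq hc ⟨hc.1.trans ht.1, ht.2.trans hd.2⟩]; abel⟩

theorem HasW11Deriv.congr {z z' : ℝ → X} (hab : a ≤ b) (h : HasW11Deriv a b w w')
    (hz : ∀ t ∈ Icc a b, z t = w t)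
    (hz' : ∀ᵐ t ∂volume.restrict (Icc a b), z' t = w' t) : HasW11Deriv a b z z' := by
  have e : ∀ t ∈ Icc a b, w' =ᵐ[volume.restrict (uIoc a t)] z' := fun t ht => by
    rw [uIoc_of_le ht.1]
    refine ae_mono (Measure.restrict_mono ?_ le_rfl) (hz'.mono fun _ h => h.symm)
    exact fun s hs => ⟨hs.1.le, hs.2.trans ht.2⟩
  refine ⟨h.1.congr_ae (e b ⟨hab, le_rfl⟩), fun t ht => ?_⟩
  rw [hz t ht, hz a ⟨le_rfl, hab⟩, h.2 t ht]
  congr 1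
  exact intervalIntegral.integral_congr_ae_restrict (e t ht)

theorem HasW11Deriv.sub {z z' : ℝ → X} (h : HasW11Deriv a b w w') (hz : HasW11Deriv a b z z') :
    HasW11Deriv a b (fun t => w t - z t) (fun t => w' t - z' t) := by
  refine ⟨h.1.sub hz.1, fun t ht => ?_⟩
  have ha : a ∈ Icc a b := ⟨le_rfl, ht.1.trans ht.2⟩
  rw [intervalIntegral.integral_sub (h.intervalIntegrable ha ht) (hz.intervalIntegrable ha ht),
    ← h.sub_eq ha ht, ← hz.sub_eq ha ht]
  dsimp only
  abel

theorem HasW11Deriv.const_smul (h : HasW11Deriv a b w w') (c : ℝ) :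
    HasW11Deriv a b (fun t => c • w t) (fun t => c • w' t) := by
  refine ⟨h.1.smul c, fun t ht => ?_⟩
  dsimp only
  rw [intervalIntegral.integral_smul, h.2 t ht, smul_add]

/-- Integral form of Grönwall's inequality. -/
theorem le_mul_exp_of_le_add_integral {r : ℝ → ℝ} {c K : ℝ} (hK : 0 ≤ K) (hc : 0 ≤ c)
    (hr : ContinuousOn r (Icc a b)) (hr0 : ∀ t ∈ Icc a b, 0 ≤ r t)
    (h : ∀ t ∈ Icc a b, r t ≤ c + K * ∫ s in a..t, r s) :
    ∀ t ∈ Icc a b, r t ≤ c * Real.exp (K * (t - a)) := by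
  intro t ht
  have hab : a ≤ b := ht.1.trans ht.2
  -- Extending `r` by its endpoint values makes the integrand continuous on the whole line, so the
  -- majorant `R` is differentiable everywhere and the differential Grönwall bound applies to it.
  set r₁ : ℝ → ℝ := fun s => r (projIcc a b hab s) with hr₁
  have hr₁c : Continuous r₁ := hr.domRestrict.comp continuous_projIcc
  have e : ∀ s ∈ Icc a b, r₁ s = r s := fun s hs => by simp [hr₁, projIcc_of_mem hab hs]
  have hr₁0 : ∀ s, 0 ≤ r₁ s := fun s => hr0 _ (projIcc a b hab s).2
  have ei : ∀ s ∈ Icc a b, ∫ τ in a..s, r τ = ∫ τ in a..s, r₁ τ := fun s hs => by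
    refine intervalIntegral.integral_congr fun τ hτ => ?_
    rw [uIcc_of_le hs.1] at hτ
    exact (e τ ⟨hτ.1, hτ.2.trans hs.2⟩).symm
  set R : ℝ → ℝ := fun s => c + K * ∫ τ in a..s, r₁ τ
  have hRd : ∀ s, HasDerivAt R (K * r₁ s) s := fun s => by
    have := intervalIntegral.integral_hasDerivAt_right (hr₁c.intervalIntegrable a s)
      hr₁c.stronglyMeasurable.stronglyMeasurableAtFilter hr₁c.continuousAt
    exact (this.const_mul K).const_add c
  have hR0 : ∀ s ∈ Icc a b, 0 ≤ R s := fun s hs => by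
    have := intervalIntegral.integral_nonneg (μ := volume) hs.1 (fun τ _ => hr₁0 τ)
    positivity
  have key := norm_le_gronwallBound_of_norm_deriv_right_le (f := R) (f' := fun s => K * r₁ s)
    (δ := c) (K := K) (ε := 0) (a := a) (b := b)
    (fun s _ => (hRd s).continuousAt.continuousWithinAt)
    (fun s _ => (hRd s).hasDerivWithinAt) (by simp [R, abs_of_nonneg hc])
    (fun s hs => by
      have hs' : s ∈ Icc a b := ⟨hs.1, hs.2.le⟩
      rw [add_zero, Real.norm_of_nonneg (mul_nonneg hK (hr₁0 s)), Real.norm_of_nonneg (hR0 s hs')]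
      refine mul_le_mul_of_nonneg_left ?_ hK
      rw [e s hs']
      exact (h s hs').trans_eq (by simp only [R, ei s hs'])) t ht
  rw [gronwallBound_ε0, Real.norm_of_nonneg (hR0 t ht)] at key
  refine le_trans ?_ key
  exact (h t ht).trans_eq (by simp only [R, ei t ht])

/-- Grönwall's inequality for `W^{1,1}` arcs. -/
theorem HasW11Deriv.norm_le (h : HasW11Deriv a b w w') {K : ℝ} {e : ℝ → ℝ} (hK : 0 ≤ K)
    (he : IntervalIntegrable e volume a b) (he0 : ∀ t, 0 ≤ e t)
    (hw : ∀ᵐ t ∂volume.restrict (Icc a b), ‖w' t‖ ≤ K * ‖w t‖ + e t) :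
    ∀ t ∈ Icc a b, ‖w t‖ ≤ (‖w a‖ + ∫ s in a..b, e s) * Real.exp (K * (b - a)) := by
  intro t ht
  have hab : a ≤ b := ht.1.trans ht.2
  have ha : a ∈ Icc a b := ⟨le_rfl, hab⟩
  have hb : b ∈ Icc a b := ⟨hab, le_rfl⟩
  have hwc : ContinuousOn (fun t => ‖w t‖) (Icc a b) := h.continuousOn.norm
  have hI : ∀ s ∈ Icc a b, ∀ {f : ℝ → ℝ}, IntervalIntegrable f volume a b →
      IntervalIntegrable f volume a s := fun s hs f hf =>
    hf.mono_set (uIcc_subset_uIcc left_mem_uIcc (Icc_subset_uIcc hs))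
  have hwi : IntervalIntegrable (fun t => ‖w t‖) volume a b :=
    ContinuousOn.intervalIntegrable (by rwa [uIcc_of_le hab])
  have he_nonneg : 0 ≤ ∫ s in a..b, e s := intervalIntegral.integral_nonneg hab fun s _ => he0 s
  have key := le_mul_exp_of_le_add_integral hK (c := ‖w a‖ + ∫ s in a..b, e s) (by positivity)
    hwc (fun _ _ => norm_nonneg _) (fun s hs => by
      have h1 : ‖w s‖ ≤ ‖w a‖ + ‖∫ τ in a..s, w' τ‖ := by
        rw [h.2 s hs]; exact norm_add_le _ _
      have h2 : ‖∫ τ in a..s, w' τ‖ ≤ ∫ τ in a..s, (K * ‖w τ‖ + e τ) := by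
        refine intervalIntegral.norm_integral_le_of_norm_le hs.1 ?_
          (((hI s hs hwi).const_mul K).add (hI s hs he))
        have := (ae_restrict_iff' measurableSet_Icc).1 hw
        filter_upwards [this] with τ hτ hτ'
        exact hτ ⟨hτ'.1.le, hτ'.2.trans hs.2⟩
      rw [intervalIntegral.integral_add ((hI s hs hwi).const_mul K) (hI s hs he),
        intervalIntegral.integral_const_mul] at h2
      have h3 : ∫ τ in a..s, e τ ≤ ∫ τ in a..b, e τ :=
        intervalIntegral.integral_mono_interval le_rfl hs.1 hs.2
          (Eventually.of_forall he0) he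
      linarith) t ht
  refine key.trans (mul_le_mul_of_nonneg_left ?_ (by positivity))
  exact Real.exp_le_exp.2 (mul_le_mul_of_nonneg_left (by linarith [ht.2]) hK)

/-- Grönwall with zero data. Forward uniqueness rests on it: linearity of the flow, and
identification of a given arc with the Picard solution. -/
theorem HasW11Deriv.eqOn_zero (h : HasW11Deriv a b w w') {K : ℝ} (hK : 0 ≤ K)
    (hwa : w a = 0) (hw : ∀ᵐ t ∂volume.restrict (Icc a b), ‖w' t‖ ≤ K * ‖w t‖) :
    ∀ t ∈ Icc a b, w t = 0 := by
  intro t ht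
  have := h.norm_le hK (e := fun _ => 0) (by simp) (fun _ => le_rfl)
    (by simpa using hw) t ht
  simpa [hwa] using this

end Arcs

/-! ### The product rule -/

theorem absolutelyContinuousOnInterval_of_dist_le {X Y : Type*} [PseudoMetricSpace X]
    [PseudoMetricSpace Y] {a b : ℝ} {f : ℝ → X} {k : ℝ → Y}
    (hk : AbsolutelyContinuousOnInterval k a b)
    (h : ∀ s ∈ uIcc a b, ∀ t ∈ uIcc a b, dist (f s) (f t) ≤ dist (k s) (k t)) :
    AbsolutelyContinuousOnInterval f a b := by
  rw [absolutelyContinuousOnInterval_iff] at hk ⊢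
  intro ε hε
  obtain ⟨δ, hδ, H⟩ := hk ε hε
  refine ⟨δ, hδ, fun E hE hl => lt_of_le_of_lt (Finset.sum_le_sum fun i hi => ?_) (H E hE hl)⟩
  exact h _ (hE.1 i hi).1 _ (hE.1 i hi).2

/-- The pairing is a scalar function whose increments are dominated by those of the primitive of an
integrable function. It is therefore absolutely continuous and the integral of its derivative, which
the ordinary product rule computes almost everywhere. -/
theorem HasW11Deriv.inner_sub_inner {H : Type*} [NormedAddCommGroup H] [InnerProductSpace ℝ H]
    [CompleteSpace H] {a b : ℝ} (hab : a ≤ b) {v v' w w' : ℝ → H} (hv : HasW11Deriv a b v v')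
    (hw : HasW11Deriv a b w w') :
    inner ℝ (v b) (w b) - inner ℝ (v a) (w a) =
      ∫ t in a..b, (inner ℝ (v' t) (w t) + inner ℝ (v t) (w' t)) := by
  -- The primitives agree with `v` and `w` on the interval but are defined on all of `ℝ`, so
  -- two-sided derivatives make sense up to the endpoints.
  set V : ℝ → H := fun t => v a + ∫ s in a..t, v' s with hV
  set W : ℝ → H := fun t => w a + ∫ s in a..t, w' s with hW
  have hu : uIcc a b = Icc a b := uIcc_of_le hab
  have ha : a ∈ Icc a b := ⟨le_rfl, hab⟩
  have hb : b ∈ Icc a b := ⟨hab, le_rfl⟩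
  have hVv : ∀ t ∈ Icc a b, V t = v t := fun t ht => (hv.2 t ht).symm
  have hWw : ∀ t ∈ Icc a b, W t = w t := fun t ht => (hw.2 t ht).symm
  obtain ⟨M, hM⟩ := isCompact_Icc.exists_bound_of_continuousOn hv.continuousOn
  obtain ⟨N, hN⟩ := isCompact_Icc.exists_bound_of_continuousOn hw.continuousOn
  have hM0 : 0 ≤ M := (norm_nonneg _).trans (hM a ha)
  have hN0 : 0 ≤ N := (norm_nonneg _).trans (hN a ha)
  set e : ℝ → ℝ := fun t => N * ‖v' t‖ + M * ‖w' t‖ with he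
  have hei : IntervalIntegrable e volume a b := (hv.1.norm.const_mul N).add (hw.1.norm.const_mul M)
  have hdist : ∀ s ∈ Icc a b, ∀ t ∈ Icc a b, s ≤ t →
      |inner ℝ (V s) (W s) - inner ℝ (V t) (W t)| ≤
        |(∫ r in a..s, e r) - ∫ r in a..t, e r| := by
    intro s hs t ht hst
    have hes : IntervalIntegrable e volume a s :=
      hei.mono_set (uIcc_subset_uIcc left_mem_uIcc (Icc_subset_uIcc hs))
    have het : IntervalIntegrable e volume a t :=
      hei.mono_set (uIcc_subset_uIcc left_mem_uIcc (Icc_subset_uIcc ht))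
    rw [hVv s hs, hVv t ht, hWw s hs, hWw t ht, abs_sub_comm, abs_sub_comm (∫ r in a..s, e r),
      intervalIntegral.integral_interval_sub_left het hes]
    have h1 : inner ℝ (v t) (w t) - inner ℝ (v s) (w s) =
        inner ℝ (v t - v s) (w t) + inner ℝ (v s) (w t - w s) := by
      simp only [inner_sub_left, inner_sub_right]; ring
    have h2 : ‖v t - v s‖ ≤ ∫ r in s..t, ‖v' r‖ := by
      rw [hv.sub_eq hs ht]; exact intervalIntegral.norm_integral_le_integral_norm hst
    have h3 : ‖w t - w s‖ ≤ ∫ r in s..t, ‖w' r‖ := by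
      rw [hw.sub_eq hs ht]; exact intervalIntegral.norm_integral_le_integral_norm hst
    have h4 : ∫ r in s..t, e r = N * (∫ r in s..t, ‖v' r‖) + M * ∫ r in s..t, ‖w' r‖ := by
      rw [intervalIntegral.integral_add ((hv.intervalIntegrable hs ht).norm.const_mul N)
        ((hw.intervalIntegrable hs ht).norm.const_mul M), intervalIntegral.integral_const_mul,
        intervalIntegral.integral_const_mul]
    refine le_trans ?_ (le_abs_self _)
    rw [h1, h4]
    refine (abs_add_le _ _).trans (add_le_add ?_ ?_)
    · refine (abs_real_inner_le_norm _ _).trans ?_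
      rw [mul_comm]
      exact mul_le_mul (hN t ht) h2 (norm_nonneg _) hN0
    · refine (abs_real_inner_le_norm _ _).trans ?_
      exact mul_le_mul (hM s hs) h3 (norm_nonneg _) hM0
  have hac : AbsolutelyContinuousOnInterval (fun t => (inner ℝ (V t) (W t) : ℝ)) a b := by
    refine absolutelyContinuousOnInterval_of_dist_le
      (hei.absolutelyContinuousOnInterval_intervalIntegral (c := a) left_mem_uIcc) ?_
    rw [hu]
    intro s hs t ht
    simp only [Real.dist_eq]
    rcases le_total s t with hst | hst
    · exact hdist s hs t ht hst
    · rw [abs_sub_comm, abs_sub_comm (∫ r in a..s, e r)]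
      exact hdist t ht s hs hst
  have hfin := hac.integral_deriv_eq_sub
  rw [hVv b hb, hWw b hb, hVv a ha, hWw a ha] at hfin
  rw [← hfin]
  refine intervalIntegral.integral_congr_ae ?_
  filter_upwards [hv.1.ae_hasDerivAt_integral, hw.1.ae_hasDerivAt_integral] with t h1 h2 ht
  have ht' : t ∈ uIcc a b := uIoc_subset_uIcc ht
  have d1 : HasDerivAt V (v' t) t := (h1 ht' a left_mem_uIcc).const_add (v a)
  have d2 : HasDerivAt W (w' t) t := (h2 ht' a left_mem_uIcc).const_add (w a)
  have := (d1.inner ℝ d2).deriv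
  rw [this, hVv t (hu ▸ ht'), hWw t (hu ▸ ht')]
  ring

/-! ### Carathéodory differential equations -/

/-- The hypotheses of the global Picard theorem for `ẏ = F(t, y)`: measurability in time, a uniform
Lipschitz bound in the state and a uniform bound at the origin. -/
structure IsCaratheodory {X : Type*} [NormedAddCommGroup X] (F : ℝ → X → X) (K M : ℝ) : Prop where
  pos : 0 < K
  meas : ∀ x, StronglyMeasurable fun t => F t x
  lip : ∀ t x y, ‖F t x - F t y‖ ≤ K * ‖x - y‖
  bound : ∀ t, ‖F t 0‖ ≤ M

theorem IsCaratheodory.continuous {X : Type*} [NormedAddCommGroup X] {F : ℝ → X → X} {K M : ℝ}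
    (hF : IsCaratheodory F K M) (t : ℝ) : Continuous (F t) :=
  (LipschitzWith.of_dist_le_mul (K := K.toNNReal) fun x y => by
    rw [dist_eq_norm, dist_eq_norm, Real.coe_toNNReal K hF.pos.le]; exact hF.lip t x y).continuous

theorem IsCaratheodory.norm_le {X : Type*} [NormedAddCommGroup X] {F : ℝ → X → X} {K M : ℝ}
    (hF : IsCaratheodory F K M) (t : ℝ) (x : X) :
    ‖F t x‖ ≤ K * ‖x‖ + M := by
  have h1 := hF.lip t x 0
  have h2 := hF.bound t
  rw [sub_zero] at h1
  have h3 : ‖F t x‖ ≤ ‖F t x - F t 0‖ + ‖F t 0‖ := by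
    simpa using norm_add_le (F t x - F t 0) (F t 0)
  linarith

/-- The exponent `2 * K` is chosen so that integrating `K` times the weight returns at most half of
the weight: the Picard map then contracts by `1/2` on intervals of any length. -/
theorem integral_exp_weight_le (K a t : ℝ) :
    ∫ s in a..t, K * Real.exp (2 * K * (s - a)) ≤ 2⁻¹ * Real.exp (2 * K * (t - a)) := by
  have hd : ∀ s, HasDerivAt (fun s => 2⁻¹ * Real.exp (2 * K * (s - a)))
      (K * Real.exp (2 * K * (s - a))) s := fun s => by
    have h1 : HasDerivAt (fun s => 2 * K * (s - a)) (2 * K) s := by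
      simpa using ((hasDerivAt_id s).sub_const a).const_mul (2 * K)
    convert! (h1.exp.const_mul 2⁻¹) using 1
    ring
  rw [intervalIntegral.integral_eq_sub_of_hasDerivAt (fun s _ => hd s)
    (Continuous.intervalIntegrable (by fun_prop) _ _)]
  have := Real.exp_pos (2 * K * (a - a))
  linarith

/-- Measurable in time and continuous in the state implies jointly measurable when the state space
is second countable. -/
theorem IsCaratheodory.stronglyMeasurable_comp {X : Type*} [NormedAddCommGroup X]
    [SecondCountableTopology X] {F : ℝ → X → X} {K M : ℝ} (hF : IsCaratheodory F K M) {y : ℝ → X}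
    (hy : StronglyMeasurable y) : StronglyMeasurable fun t => F t (y t) := by
  borelize X
  have := stronglyMeasurable_uncurry_of_continuous_of_stronglyMeasurable
    (u := fun x t => F t x) hF.continuous hF.meas
  exact this.comp_measurable (hy.measurable.prodMk measurable_id)

theorem IsCaratheodory.intervalIntegrable {X : Type*} [NormedAddCommGroup X]
    [SecondCountableTopology X] {F : ℝ → X → X} {K M : ℝ} (hF : IsCaratheodory F K M) {y : ℝ → X}
    (hy : Continuous y) (s t : ℝ) : IntervalIntegrable (fun r => F r (y r)) volume s t := by
  refine IntervalIntegrable.mono_fun' (g := fun r => K * ‖y r‖ + M) ?_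
    (hF.stronglyMeasurable_comp hy.stronglyMeasurable).aestronglyMeasurable
    (Eventually.of_forall fun r => hF.norm_le r (y r))
  exact Continuous.intervalIntegrable (by fun_prop) _ _

/-! ### Picard iteration in an exponentially weighted norm -/

section Picard

variable {X : Type*} [NormedAddCommGroup X] [NormedSpace ℝ X]

/-- The Picard iterates of `ẏ = F(t, y)`, `y(a) = y₀`, frozen before the initial time. -/
noncomputable def picardIter (F : ℝ → X → X) (a : ℝ) (y₀ : X) : ℕ → ℝ → X
  | 0 => fun _ => y₀
  | k + 1 => fun t => y₀ + ∫ s in a..max a t, F s (picardIter F a y₀ k s)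

/-- The limit of the Picard iterates. -/
noncomputable def picardSol (F : ℝ → X → X) (a : ℝ) (y₀ : X) (t : ℝ) : X :=
  limUnder atTop fun k => picardIter F a y₀ k t

variable {F : ℝ → X → X} {K M : ℝ}

/-- Freezing before the initial time lets estimates proved for `a ≤ t` be used at every `t`. -/
theorem picardIter_max (a : ℝ) (y₀ : X) (k : ℕ) (t : ℝ) :
    picardIter F a y₀ k (max a t) = picardIter F a y₀ k t := by
  cases k <;> simp [picardIter]

theorem picardSol_max (a : ℝ) (y₀ : X) (t : ℝ) :
    picardSol F a y₀ (max a t) = picardSol F a y₀ t := by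
  simp only [picardSol, picardIter_max]

variable [SecondCountableTopology X]

theorem IsCaratheodory.continuous_integral (hF : IsCaratheodory F K M) {y : ℝ → X}
    (hy : Continuous y) (a : ℝ) (y₀ : X) :
    Continuous fun t => y₀ + ∫ s in a..max a t, F s (y s) := by
  have := intervalIntegral.continuous_primitive (hF.intervalIntegrable hy) a
  exact continuous_const.add (this.comp (continuous_const.max continuous_id))

theorem IsCaratheodory.continuous_picardIter (hF : IsCaratheodory F K M) (a : ℝ) (y₀ : X) (k : ℕ) :
    Continuous (picardIter F a y₀ k) := by
  induction k with
  | zero => exact continuous_const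
  | succ k ih => exact hF.continuous_integral ih a y₀

/-- The contraction step: a weighted distance `C` between two curves becomes `C / 2` after one
application of the integral operator. -/
theorem IsCaratheodory.norm_integral_sub_le (hF : IsCaratheodory F K M) {y z : ℝ → X}
    (hy : Continuous y) (hz : Continuous z) {a C : ℝ} (hC : 0 ≤ C)
    (h : ∀ t, a ≤ t → ‖y t - z t‖ ≤ C * Real.exp (2 * K * (t - a))) {t : ℝ} (ht : a ≤ t) :
    ‖(∫ s in a..t, F s (y s)) - ∫ s in a..t, F s (z s)‖ ≤
      C * 2⁻¹ * Real.exp (2 * K * (t - a)) := by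
  rw [← intervalIntegral.integral_sub (hF.intervalIntegrable hy _ _)
    (hF.intervalIntegrable hz _ _)]
  have h1 : ‖∫ s in a..t, (F s (y s) - F s (z s))‖ ≤
      ∫ s in a..t, C * (K * Real.exp (2 * K * (s - a))) := by
    refine intervalIntegral.norm_integral_le_of_norm_le ht (Eventually.of_forall fun s hs => ?_)
      (Continuous.intervalIntegrable (by fun_prop) _ _)
    refine (hF.lip s _ _).trans ?_
    have := mul_le_mul_of_nonneg_left (h s hs.1.le) hF.pos.le
    linarith
  rw [intervalIntegral.integral_const_mul] at h1
  have h2 := mul_le_mul_of_nonneg_left (integral_exp_weight_le K a t) hC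
  linarith

theorem IsCaratheodory.norm_picardIter_sub_le (hF : IsCaratheodory F K M) (a : ℝ) (y₀ : X) (k : ℕ)
    {t : ℝ} (ht : a ≤ t) :
    ‖picardIter F a y₀ (k + 1) t - picardIter F a y₀ k t‖ ≤
      (‖y₀‖ + M / K) * 2⁻¹ ^ k * Real.exp (2 * K * (t - a)) := by
  have hM : 0 ≤ M := (norm_nonneg _).trans (hF.bound 0)
  have hK := hF.pos
  induction k generalizing t with
  | zero =>
    simp only [picardIter, max_eq_right ht, add_sub_cancel_left, pow_zero, mul_one]
    have h1 : ‖∫ s in a..t, F s y₀‖ ≤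
        ∫ s in a..t, (‖y₀‖ + M / K) * (K * Real.exp (2 * K * (s - a))) := by
      refine intervalIntegral.norm_integral_le_of_norm_le ht (Eventually.of_forall fun s hs => ?_)
        (Continuous.intervalIntegrable (by fun_prop) _ _)
      refine (hF.norm_le s y₀).trans ?_
      have h1 : (1 : ℝ) ≤ Real.exp (2 * K * (s - a)) :=
        Real.one_le_exp (by have := hs.1; nlinarith)
      -- This is where the constant `‖y₀‖ + M / K` comes from: it turns the growth bound into a
      -- multiple of `K`, the shape the weight integral accepts.
      have h2 : K * ‖y₀‖ + M = (‖y₀‖ + M / K) * (K * 1) := by field_simp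
      rw [h2]
      gcongr
    rw [intervalIntegral.integral_const_mul] at h1
    have h2 := mul_le_mul_of_nonneg_left (integral_exp_weight_le K a t)
      (show 0 ≤ ‖y₀‖ + M / K by positivity)
    have h3 : 0 ≤ (‖y₀‖ + M / K) * Real.exp (2 * K * (t - a)) := by positivity
    linarith
  | succ k ih =>
    have := hF.norm_integral_sub_le (hF.continuous_picardIter a y₀ (k + 1))
      (hF.continuous_picardIter a y₀ k) (C := (‖y₀‖ + M / K) * 2⁻¹ ^ k) (by positivity)
      (fun t ht => ih ht) ht
    rw [picardIter, picardIter]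
    simp only [max_eq_right ht, add_sub_add_left_eq_sub]
    rw [pow_succ, ← mul_assoc]
    exact this

variable [CompleteSpace X]

theorem IsCaratheodory.tendsto_picardIter (hF : IsCaratheodory F K M) (a : ℝ) (y₀ : X) (t : ℝ) :
    Tendsto (fun k => picardIter F a y₀ k t) atTop (𝓝 (picardSol F a y₀ t)) := by
  refine CauchySeq.tendsto_limUnder ?_
  refine cauchySeq_of_le_geometric 2⁻¹ ((‖y₀‖ + M / K) * Real.exp (2 * K * (max a t - a)))
    (by norm_num) fun k => ?_
  rw [← picardIter_max, ← picardIter_max a y₀ (k + 1), dist_comm, dist_eq_norm]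
  refine (hF.norm_picardIter_sub_le a y₀ k (le_max_left a t)).trans_eq ?_
  ring

theorem IsCaratheodory.norm_picardIter_sub_picardSol_le (hF : IsCaratheodory F K M) (a : ℝ) (y₀ : X)
    (k : ℕ) {t : ℝ} (ht : a ≤ t) :
    ‖picardIter F a y₀ k t - picardSol F a y₀ t‖ ≤
      2 * (‖y₀‖ + M / K) * 2⁻¹ ^ k * Real.exp (2 * K * (t - a)) := by
  have := dist_le_of_le_geometric_of_tendsto 2⁻¹
    ((‖y₀‖ + M / K) * Real.exp (2 * K * (t - a))) (by norm_num) (fun k => ?_)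
    (hF.tendsto_picardIter a y₀ t) k
  · rw [dist_eq_norm] at this
    refine this.trans_eq ?_
    norm_num
    ring
  · rw [dist_comm, dist_eq_norm]
    refine (hF.norm_picardIter_sub_le a y₀ k ht).trans_eq ?_
    ring

theorem IsCaratheodory.continuous_picardSol (hF : IsCaratheodory F K M) (a : ℝ) (y₀ : X) :
    Continuous (picardSol F a y₀) := by
  have h : TendstoLocallyUniformly (picardIter F a y₀) (picardSol F a y₀) atTop := by
    rw [Metric.tendstoLocallyUniformly_iff]
    intro ε hε t
    refine ⟨Iio (t + 1), Iio_mem_nhds (by linarith), ?_⟩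
    have hlim : Tendsto (fun k : ℕ => 2 * (‖y₀‖ + M / K) * 2⁻¹ ^ k *
        Real.exp (2 * K * (max a (t + 1) - a))) atTop (𝓝 0) := by
      have := tendsto_pow_atTop_nhds_zero_of_lt_one (r := (2⁻¹ : ℝ)) (by norm_num) (by norm_num)
      simpa using (this.const_mul (2 * (‖y₀‖ + M / K))).mul_const
        (Real.exp (2 * K * (max a (t + 1) - a)))
    filter_upwards [hlim.eventually_lt_const hε] with k hk s hs
    have hM : 0 ≤ M := (norm_nonneg _).trans (hF.bound 0)
    have hK := hF.pos
    rw [dist_comm, dist_eq_norm, ← picardSol_max, ← picardIter_max]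
    refine ((hF.norm_picardIter_sub_picardSol_le a y₀ k (le_max_left a s)).trans ?_).trans_lt hk
    gcongr
    exact (mem_Iio.1 hs).le
  exact h.continuous (Frequently.of_forall fun k => hF.continuous_picardIter a y₀ k)

theorem IsCaratheodory.picardSol_eq (hF : IsCaratheodory F K M) (a : ℝ) (y₀ : X) {t : ℝ}
    (ht : a ≤ t) : picardSol F a y₀ t = y₀ + ∫ s in a..t, F s (picardSol F a y₀ s) := by
  refine tendsto_nhds_unique ((hF.tendsto_picardIter a y₀ t).comp (tendsto_add_atTop_nat 1)) ?_
  have hM : 0 ≤ M := (norm_nonneg _).trans (hF.bound 0)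
  have hK := hF.pos
  have hc := hF.continuous_picardSol a y₀
  simp only [Function.comp_def, picardIter, max_eq_right ht]
  refine tendsto_const_nhds.add ?_
  rw [tendsto_iff_norm_sub_tendsto_zero]
  refine squeeze_zero (fun _ => norm_nonneg _) (fun k => hF.norm_integral_sub_le
    (hF.continuous_picardIter a y₀ k) hc (C := 2 * (‖y₀‖ + M / K) * 2⁻¹ ^ k) (by positivity)
    (fun s hs => hF.norm_picardIter_sub_picardSol_le a y₀ k hs) ht) ?_
  have := tendsto_pow_atTop_nhds_zero_of_lt_one (r := (2⁻¹ : ℝ)) (by norm_num) (by norm_num)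
  simpa using ((this.const_mul (2 * (‖y₀‖ + M / K))).mul_const 2⁻¹).mul_const
        (Real.exp (2 * K * (t - a)))

theorem IsCaratheodory.picardSol_self (hF : IsCaratheodory F K M) (a : ℝ) (y₀ : X) :
    picardSol F a y₀ a = y₀ := by
  simpa using hF.picardSol_eq a y₀ le_rfl

theorem IsCaratheodory.hasW11Deriv_picardSol (hF : IsCaratheodory F K M) (a b : ℝ) (y₀ : X) :
    HasW11Deriv a b (picardSol F a y₀) fun t => F t (picardSol F a y₀ t) :=
  ⟨hF.intervalIntegrable (hF.continuous_picardSol a y₀) _ _, fun t ht => by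
    rw [hF.picardSol_self, ← hF.picardSol_eq a y₀ ht.1]⟩

/-- Solutions of Carathéodory equations depend measurably on parameters. -/
theorem measurable_picardSol {Ω : Type*} [MeasurableSpace Ω] [MeasurableSpace X] [BorelSpace X]
    {F : Ω → ℝ → X → X} {K : ℝ} {M : Ω → ℝ} (hF : ∀ ω, IsCaratheodory (F ω) K (M ω))
    (hFm : ∀ x, Measurable fun z : ℝ × Ω => F z.2 z.1 x) (a : ℝ) {y₀ : Ω → X}
    (hy₀ : Measurable y₀) :
    Measurable fun z : ℝ × Ω => picardSol (F z.2) a (y₀ z.2) z.1 := by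
  have hk : ∀ k, Measurable fun z : ℝ × Ω => picardIter (F z.2) a (y₀ z.2) k z.1 := by
    intro k
    induction k with
    | zero => exact hy₀.comp measurable_snd
    | succ k ih =>
      -- Continuity in time reduces joint measurability of an iterate to measurability in the
      -- parameter at fixed time, where Fubini handles the integral.
      refine measurable_uncurry_of_continuous_of_measurable
        (u := fun t ω => picardIter (F ω) a (y₀ ω) (k + 1) t)
        (fun ω => (hF ω).continuous_picardIter a (y₀ ω) (k + 1)) fun t => ?_
      simp only [picardIter]
      refine hy₀.add ?_
      have h1 := measurable_uncurry_of_continuous_of_measurable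
        (u := fun x (z : ℝ × Ω) => F z.2 z.1 x) (fun z => (hF z.2).continuous z.1) hFm
      have h2 : Measurable fun z : ℝ × Ω => F z.2 z.1 (picardIter (F z.2) a (y₀ z.2) k z.1) :=
        h1.comp (ih.prodMk measurable_id)
      simp only [intervalIntegral.integral_of_le (le_max_left a t)]
      exact (h2.stronglyMeasurable.integral_prod_left'
        (μ := volume.restrict (Ioc a (max a t)))).measurable
  exact measurable_of_tendsto_metrizable hk (tendsto_pi_nhds.2 fun z =>
    (hF z.2).tendsto_picardIter a (y₀ z.2) z.1)

end Picard

/-! ### Measurable selection -/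

/-- A set which is measurable for (completed σ-algebra) × (σ-algebra) agrees with a measurable set
off a null set of the first coordinates. -/
theorem exists_measurableSet_of_nullMeasurable_prod {α V : Type*} [MeasurableSpace α]
    [MeasurableSpace V] {μ : Measure α} {E : Set (NullMeasurableSpace α μ × V)}
    (hE : MeasurableSet E) :
    ∃ B : Set (α × V), MeasurableSet B ∧ ∀ᵐ t ∂μ, ∀ v, (t, v) ∈ E ↔ (t, v) ∈ B := by
  rw [← generateFrom_prod] at hE
  induction E, hE using MeasurableSpace.generateFrom_induction with
  | hC S hS _ =>
    obtain ⟨A, hA, C, hC, rfl⟩ := hS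
    have hA' : NullMeasurableSet (α := α) A μ := hA
    refine ⟨toMeasurable μ A ×ˢ C, (measurableSet_toMeasurable μ A).prod hC, ?_⟩
    filter_upwards [hA'.toMeasurable_ae_eq.mem_iff] with t ht v
    exact and_congr ht.symm Iff.rfl
  | empty => exact ⟨∅, .empty, Eventually.of_forall fun t v =>
      iff_of_false (notMem_empty _) (notMem_empty _)⟩
  | compl S _ ih =>
    obtain ⟨B, hB, h⟩ := ih
    exact ⟨Bᶜ, hB.compl, h.mono fun t ht v => not_congr (ht v)⟩
  | iUnion S _ ih =>
    choose B hB h using ih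
    refine ⟨⋃ i, B i, .iUnion hB, ?_⟩
    filter_upwards [ae_all_iff.2 h] with t ht v
    exact mem_iUnion.trans ((exists_congr fun i => ht i v).trans (mem_iUnion (s := B)).symm)

/-- An analytic set which is not null contains a compact image which is not null. -/
theorem exists_isCompact_measure_image_ne_zero {X : Type*} [TopologicalSpace X]
    [MeasurableSpace X] (μ : Measure X) [μ.OuterRegular] {g : (ℕ → ℕ) → X} (hg : Continuous g)
    (h : μ (range g) ≠ 0) : ∃ K : Set (ℕ → ℕ), IsCompact K ∧ μ (g '' K) ≠ 0 := by
  obtain ⟨c, hc0, hc⟩ := exists_between (pos_iff_ne_zero.2 h)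
  -- Bounding one coordinate exhausts the set as the bound grows, and continuity from below, valid
  -- for the outer measure of arbitrary sets, keeps the image larger than `c`.
  have step : ∀ (S : Set (ℕ → ℕ)) (k : ℕ), ∃ j, c < μ (g '' S) →
      c < μ (g '' (S ∩ {x | x k ≤ j})) := by
    intro S k
    by_cases hS : c < μ (g '' S)
    · have hmono : Monotone fun j => g '' (S ∩ {x | x k ≤ j}) := fun i j hij =>
        image_mono (inter_subset_inter_right _ fun x hx => le_trans hx hij)
      have hU : g '' S = ⋃ j, g '' (S ∩ {x | x k ≤ j}) := by
        rw [← image_iUnion, ← inter_iUnion]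
        congr 1
        refine (inter_eq_left.2 fun x _ => ?_).symm
        exact mem_iUnion.2 ⟨x k, by simp⟩
      rw [hU, hmono.measure_iUnion] at hS
      obtain ⟨j, hj⟩ := lt_iSup_iff.1 hS
      exact ⟨j, fun _ => hj⟩
    · exact ⟨0, fun h => absurd h hS⟩
  choose j hj using step
  let S : ℕ → Set (ℕ → ℕ) := fun k => Nat.rec univ (fun k S => S ∩ {x | x k ≤ j S k}) k
  set n : ℕ → ℕ := fun k => j (S k) k with hn
  have hSc : ∀ k, c < μ (g '' S k) := by
    intro k
    induction k with
    | zero => simpa [S] using hc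
    | succ k ih => exact hj (S k) k ih
  have hSn : ∀ k, S k = {x | ∀ i < k, x i ≤ n i} := by
    intro k
    induction k with
    | zero => simp [S]
    | succ k ih =>
      have : S (k + 1) = S k ∩ {x | x k ≤ n k} := rfl
      rw [this]
      ext x
      rw [mem_inter_iff, ih]
      simp only [mem_ofPred_eq, Nat.lt_succ_iff_lt_or_eq]
      constructor
      · rintro ⟨h1, h2⟩ i (hi | rfl)
        exacts [h1 i hi, h2]
      · exact fun h => ⟨fun i hi => h i (Or.inl hi), h k (Or.inr rfl)⟩
  -- The box `K` bounds all coordinates at once. The measure bounds on the `S k` do not pass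
  -- directly to it; compactness has to show that some `g '' S k` already lies in a given open
  -- neighbourhood of `g '' K`.
  set K : Set (ℕ → ℕ) := pi univ fun i => Iic (n i) with hK
  have hKc : IsCompact K := isCompact_univ_pi fun i => (finite_Iic (n i)).isCompact
  refine ⟨K, hKc, fun h0 => ?_⟩
  obtain ⟨O, hO, hOo, hOc⟩ := Set.exists_isOpen_lt_of_lt (g '' K) c (h0 ▸ hc0)
  have hex : ∃ k, S k ⊆ g ⁻¹' O := by
    by_contra hno
    rw [not_exists] at hno
    choose x hxS hxO using fun k => not_subset.1 (hno k)
    -- Truncating moves the points into the box. Coordinate `i` is unchanged once the index exceeds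
    -- `i`, so original and truncated subsequences have the same limit.
    set y : ℕ → ℕ → ℕ := fun k i => min (x k i) (n i) with hy
    obtain ⟨z, hz, ψ, hψ, hlim⟩ := hKc.tendsto_subseq (x := y)
      (fun k => mem_univ_pi.2 fun i => mem_Iic.2 (min_le_right _ _))
    have hlimx : Tendsto (x ∘ ψ) atTop (𝓝 z) := by
      rw [tendsto_pi_nhds] at hlim ⊢
      intro i
      refine (hlim i).congr' ?_
      filter_upwards [eventually_gt_atTop i] with k hk
      have h1 := hxS (ψ k)
      rw [hSn] at h1
      exact min_eq_left (h1 i (hk.trans_le (hψ.id_le k)))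
    have hzO : z ∈ g ⁻¹' O := hO ⟨z, hz, rfl⟩
    obtain ⟨k, hk⟩ := (hlimx.eventually ((hOo.preimage hg).mem_nhds hzO)).exists
    exact hxO _ hk
  obtain ⟨k, hk⟩ := hex
  have := measure_mono (μ := μ) (image_subset_iff.2 hk)
  exact absurd ((hSc k).trans_le this) hOc.not_gt

/-- A compact subset of a product has a Borel section over its first projection. -/
theorem exists_measurable_section_of_isCompact {V : Type*} [MetricSpace V] [MeasurableSpace V]
    [BorelSpace V] {K : Set (ℝ × V)} (hK : IsCompact K) (hne : K.Nonempty) :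
    ∃ v : ℝ → V, Measurable v ∧ ∀ t ∈ Prod.fst '' K, (t, v t) ∈ K := by
  classical
  have : CompactSpace K := isCompact_iff_compactSpace.1 hK
  have : Nonempty K := hne.to_subtype
  obtain ⟨F, hF, hFs⟩ := exists_nat_bool_continuous_surjective_of_compact K
  let e : (ℕ → Bool) → ℝ := fun c => (cantorSetHomeomorphNatToBool.symm c : ℝ)
  have he : Continuous e := continuous_subtype_val.comp cantorSetHomeomorphNatToBool.symm.continuous
  have hei : Function.Injective e :=
    Subtype.val_injective.comp cantorSetHomeomorphNatToBool.symm.injective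
  have hπ : Continuous fun c => (F c : ℝ × V).1 := by fun_prop
  -- The Cantor space parametrises `K` and embeds in `ℝ` by `e`; in each nonempty compact fibre the
  -- point with least `e` is chosen. The constant sequence is a default off the projection.
  have hmin : ∀ t, ∃ c, (t ∈ Prod.fst '' K → (F c : ℝ × V).1 = t ∧
      ∀ d, (F d : ℝ × V).1 = t → e c ≤ e d) ∧ (t ∉ Prod.fst '' K → c = fun _ => false) := by
    intro t
    by_cases ht : t ∈ Prod.fst '' K
    · obtain ⟨z, hz, rfl⟩ := ht
      obtain ⟨c, hc⟩ := hFs ⟨z, hz⟩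
      have hcl : IsClosed {c | (F c : ℝ × V).1 = z.1} := isClosed_eq hπ continuous_const
      obtain ⟨c, hc1, hc2⟩ := hcl.isCompact.exists_isMinOn ⟨c, by simp [hc]⟩ he.continuousOn
      exact ⟨c, fun _ => ⟨hc1, fun d hd => hc2 hd⟩, fun h => absurd ⟨z, hz, rfl⟩ h⟩
    · exact ⟨fun _ => false, fun h => absurd h ht, fun _ => rfl⟩
  choose s hs hs' using hmin
  have hSm : MeasurableSet (Prod.fst '' K) := (hK.image continuous_fst).measurableSet
  have hes : Measurable fun t => e (s t) := by
    refine measurable_of_Iic fun r => ?_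
    -- The least value in a fibre is at most `r` exactly when the fibre meets the compact set `e ≤
    -- r`, so each sublevel set is, up to the default part, a compact image.
    have hset : (fun t => e (s t)) ⁻¹' Iic r =
        ((fun c => (F c : ℝ × V).1) '' {c | e c ≤ r}) ∪
          ((Prod.fst '' K)ᶜ ∩ {_t | e (fun _ => false) ≤ r}) := by
      ext t
      simp only [mem_preimage, mem_Iic, mem_union, mem_image, mem_ofPred_eq, mem_inter_iff,
        mem_compl_iff]
      by_cases ht : t ∈ Prod.fst '' K
      · constructor
        · exact fun h => Or.inl ⟨s t, h, (hs t ht).1⟩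
        · rintro (⟨c, hc, rfl⟩ | ⟨h, -⟩)
          · exact ((hs _ ht).2 c rfl).trans hc
          · exact absurd ht h
      · constructor
        · intro h
          rw [hs' t ht] at h
          exact Or.inr ⟨ht, h⟩
        · rintro (⟨c, -, rfl⟩ | ⟨-, h⟩)
          · exact absurd ⟨_, (F c).2, rfl⟩ ht
          · rwa [hs' t ht]
    rw [hset]
    have hcl : IsClosed {c | e c ≤ r} := isClosed_le he continuous_const
    exact (hcl.isCompact.image hπ).measurableSet.union (hSm.compl.inter (.const _))
  have hsm : Measurable s := (he.isClosedEmbedding hei).measurableEmbedding.measurable_comp_iff.1 hes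
  refine ⟨fun t => (F (s t) : ℝ × V).2, ?_, fun t ht => ?_⟩
  · have : Continuous fun c => (F c : ℝ × V).2 := by fun_prop
    exact this.measurable.comp hsm
  · have h1 := (hs t ht).1
    have h2 := (F (s t)).2
    rwa [← Prod.mk.eta (p := (F (s t) : ℝ × V)), h1] at h2

/-- A Borel set whose first projection is not null has a Borel section over a compact set which is
not null. -/
theorem exists_measurable_section {V : Type*} [MetricSpace V] [CompleteSpace V]
    [SecondCountableTopology V] [MeasurableSpace V] [BorelSpace V] {B : Set (ℝ × V)}
    (hB : MeasurableSet B) (h : volume (Prod.fst '' B) ≠ 0) :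
    ∃ (S : Set ℝ) (v : ℝ → V), IsCompact S ∧ volume S ≠ 0 ∧ Measurable v ∧
      ∀ t ∈ S, (t, v t) ∈ B := by
  have hBa := hB.analyticSet
  rw [AnalyticSet] at hBa
  rcases hBa with rfl | ⟨g, hg, hgB⟩
  · simp at h
  · have hr : range (fun c => (g c).1) = Prod.fst '' B := by
      rw [← hgB, ← range_comp]; rfl
    obtain ⟨K, hK, hK0⟩ := exists_isCompact_measure_image_ne_zero volume
      (g := fun c => (g c).1) (continuous_fst.comp hg) (hr ▸ h)
    have him : (fun c => (g c).1) '' K = Prod.fst '' (g '' K) := by rw [← image_comp]; rfl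
    rw [him] at hK0
    have hne : (g '' K).Nonempty := by
      by_contra hne
      rw [not_nonempty_iff_eq_empty.1 hne] at hK0
      simp at hK0
    obtain ⟨v, hv, hvK⟩ := exists_measurable_section_of_isCompact (hK.image hg) hne
    refine ⟨_, v, (hK.image hg).image continuous_fst, hK0, hv, fun t ht => ?_⟩
    rw [← hgB]
    exact image_subset_range _ _ (hvK t ht)

/-! ### Measurability -/

/-- A weakly measurable map into a separable Hilbert space is measurable. -/
theorem measurable_of_measurable_inner {α H : Type*} [MeasurableSpace α] [NormedAddCommGroup H]
    [InnerProductSpace ℝ H] [CompleteSpace H] [SecondCountableTopology H] [MeasurableSpace H]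
    [BorelSpace H] {z : α → H} (hz : ∀ h : H, Measurable fun s => inner ℝ h (z s)) :
    Measurable z := by
  -- Pairing with a dense sequence is a continuous injection of a Polish space into `ℝ^ℕ`, hence a
  -- measurable embedding by the Lusin–Souslin theorem.
  let e : H → ℕ → ℝ := fun x k => inner ℝ (TopologicalSpace.denseSeq H k) x
  have he : Continuous e := continuous_pi fun k => by fun_prop
  have hei : Function.Injective e := fun x y hxy => by
    have hd := TopologicalSpace.denseRange_denseSeq H
    have : (fun h : H => inner ℝ h x) = fun h => inner ℝ h y :=
      hd.equalizer (by fun_prop) (by fun_prop) (funext fun k => congrFun hxy k)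
    exact ext_inner_left ℝ fun h => congrFun this h
  exact (he.measurableEmbedding hei).measurable_comp_iff.1 (measurable_pi_iff.2 fun k => hz _)

/-- The derivative of a Carathéodory function is jointly measurable. -/
theorem measurable_fderiv_of_caratheodory {α E F : Type*} [MeasurableSpace α]
    [NormedAddCommGroup E] [NormedSpace ℝ E] [FiniteDimensional ℝ E] [MeasurableSpace E]
    [BorelSpace E] [NormedAddCommGroup F] [NormedSpace ℝ F] [FiniteDimensional ℝ F]
    [MeasurableSpace F] [BorelSpace F]
    {f : α → E → F} (hc : ∀ a, Continuous (f a)) (hm : ∀ x, Measurable fun a => f a x) :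
    Measurable fun p : α × E => fderiv ℝ (f p.1) p.2 := by
  have : ProperSpace E := FiniteDimensional.proper ℝ E
  have : ProperSpace F := FiniteDimensional.proper ℝ F
  borelize C(E, F)
  have : PolishSpace C(E, F) := by
    let := UniformSpace.pseudoMetricSpace C(E, F)
    let := MetricSpace.ofT0PseudoMetricSpace C(E, F)
    infer_instance
  -- Evaluation on a dense sequence embeds the Polish space of continuous maps, so `a ↦ f a` is
  -- measurable into it. There the function is itself a parameter on which evaluation depends
  -- continuously.
  let D : C(E, F) → ℕ → F := fun φ k => φ (TopologicalSpace.denseSeq E k)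
  have hD : Continuous D := continuous_pi fun k => by fun_prop
  have hDi : Function.Injective D := fun φ ψ h =>
    DFunLike.coe_injective ((TopologicalSpace.denseRange_denseSeq E).equalizer φ.continuous
      ψ.continuous (funext fun k => congrFun h k))
  have hmeas : Measurable fun a => (⟨f a, hc a⟩ : C(E, F)) :=
    (hD.measurableEmbedding hDi).measurable_comp_iff.1 (measurable_pi_iff.2 fun k => hm _)
  have h := measurable_fderiv_with_param ℝ (f := fun (φ : C(E, F)) (x : E) => φ x)
    (by unfold Function.uncurry; fun_prop)
  exact h.comp ((hmeas.comp measurable_fst).prodMk measurable_snd)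

/-! ### Classes of functions -/

section Classes

variable {Ω F : Type*} [MeasurableSpace Ω] [NormedAddCommGroup F] {p : ℝ≥0∞} {μ : Measure Ω}

theorem toLpClass_of_memLp {φ : Ω → F} (h : MemLp φ p μ) : toLpClass p μ φ = h.toLp φ := dif_pos h

theorem coeFn_toLpClass {φ : Ω → F} (h : MemLp φ p μ) : toLpClass p μ φ =ᵐ[μ] φ := by
  rw [toLpClass_of_memLp h]; exact h.coeFn_toLp

theorem toLpClass_congr {φ ψ : Ω → F} (h : φ =ᵐ[μ] ψ) : toLpClass p μ φ = toLpClass p μ ψ := by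
  by_cases hφ : MemLp φ p μ
  · have hψ := (memLp_congr_ae h).1 hφ
    rw [toLpClass_of_memLp hφ, toLpClass_of_memLp hψ]
    exact MemLp.toLp_congr _ _ h
  · have hψ : ¬MemLp ψ p μ := fun h' => hφ ((memLp_congr_ae h).2 h')
    rw [toLpClass, toLpClass, dif_neg hφ, dif_neg hψ]

theorem toLpClass_zero : toLpClass p μ (0 : Ω → F) = 0 := by
  have h : MemLp (0 : Ω → F) p μ := MemLp.zero
  exact (toLpClass_of_memLp h).trans (MemLp.toLp_zero h)

theorem toLpClass_sub {φ ψ : Ω → F} (hφ : MemLp φ p μ) (hψ : MemLp ψ p μ) :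
    toLpClass p μ φ - toLpClass p μ ψ = toLpClass p μ (fun ω => φ ω - ψ ω) := by
  rw [toLpClass_of_memLp hφ, toLpClass_of_memLp hψ]
  exact (toLpClass_of_memLp (hφ.sub hψ)).symm

theorem toLpClass_add {φ ψ : Ω → F} (hφ : MemLp φ p μ) (hψ : MemLp ψ p μ) :
    toLpClass p μ φ + toLpClass p μ ψ = toLpClass p μ (fun ω => φ ω + ψ ω) := by
  rw [toLpClass_of_memLp hφ, toLpClass_of_memLp hψ]
  exact (toLpClass_of_memLp (hφ.add hψ)).symm

theorem norm_toLpClass_le {φ : Ω → F} {w : Ω → ℝ} {c : ℝ}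
    (hw : MemLp w p μ) (hφ : AEStronglyMeasurable φ μ) (h : ∀ᵐ ω ∂μ, ‖φ ω‖ ≤ c * ‖w ω‖) :
    ‖toLpClass p μ φ‖ ≤ c * ‖toLpClass p μ w‖ := by
  have hφ' : MemLp φ p μ := hw.of_le_mul hφ h
  refine Lp.norm_le_mul_norm_of_ae_le_mul ?_
  filter_upwards [coeFn_toLpClass hφ', coeFn_toLpClass hw, h] with ω h1 h2 h3
  rwa [h1, h2]

end Classes

/-! ### Square-integrable ensembles as curves in `L²` -/

section L2

/-- Lets instance search find that `L²` of a separable measure is second countable. -/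
instance fact_two_ne_top : Fact ((2 : ℝ≥0∞) ≠ ∞) := ⟨ENNReal.ofNat_ne_top⟩

variable {Ω F : Type*} [MeasurableSpace Ω] [NormedAddCommGroup F] [InnerProductSpace ℝ F]
  {μ : Measure Ω}

theorem inner_toLpClass (h : Lp F 2 μ) {φ : Ω → F} (hφ : MemLp φ 2 μ) :
    inner ℝ h (toLpClass 2 μ φ) = ∫ ω, inner ℝ (h ω) (φ ω) ∂μ := by
  rw [L2.inner_def]
  refine integral_congr_ae ?_
  filter_upwards [coeFn_toLpClass hφ] with ω hω
  rw [hω]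

variable [FiniteDimensional ℝ F] [MeasurableSpace F] [BorelSpace F] [SFinite μ]
  [IsSeparable μ]

/-- In a separable Hilbert space weak measurability suffices, and each pairing is a parametric
integral, measurable by Fubini. -/
theorem stronglyMeasurable_toLpClass {α : Type*} [MeasurableSpace α] {Z : α → Ω → F}
    (hZ : Measurable fun z : α × Ω => Z z.1 z.2) (hZ2 : ∀ s, MemLp (Z s) 2 μ) :
    StronglyMeasurable fun s => toLpClass 2 μ (Z s) := by
  have : ProperSpace F := FiniteDimensional.proper ℝ F
  borelize ↥(Lp F 2 μ)
  refine (measurable_of_measurable_inner fun h => ?_).stronglyMeasurable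
  simp only [inner_toLpClass h (hZ2 _)]
  have hh : Measurable h := (Lp.stronglyMeasurable h).measurable
  have : Measurable fun z : α × Ω => inner ℝ (h z.2) (Z z.1 z.2) :=
    (hh.comp measurable_snd).inner hZ
  exact this.stronglyMeasurable.integral_prod_right'.measurable

/-- An ensemble of arcs with square integrable Lipschitz constants is a `W^{1,1}` arc in `L²`. -/
theorem hasW11Deriv_toLpClass {a b : ℝ} (hab : a ≤ b) {z Z : ℝ → Ω → F} {w : Ω → ℝ}
    (hw : MemLp w 2 μ) (hZ : Measurable fun y : ℝ × Ω => Z y.1 y.2)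
    (hZw : ∀ᵐ ω ∂μ, ∀ s ∈ Icc a b, ‖Z s ω‖ ≤ w ω) (hza : MemLp (z a) 2 μ)
    (hz : ∀ᵐ ω ∂μ, ∀ t ∈ Icc a b, z t ω = z a ω + ∫ s in a..t, Z s ω) :
    (∀ t ∈ Icc a b, MemLp (z t) 2 μ) ∧
      HasW11Deriv a b (fun t => toLpClass 2 μ (z t)) (fun t => toLpClass 2 μ (Z t)) := by
  have : ProperSpace F := FiniteDimensional.proper ℝ F
  -- Cutting off outside the interval makes the bound by `w` hold at all times, so every `Y s` is
  -- square integrable.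
  set Y : ℝ → Ω → F := fun s ω => (Icc a b).indicator (fun s => Z s ω) s with hY
  have hYm : Measurable fun y : ℝ × Ω => Y y.1 y.2 := by
    have : (fun y : ℝ × Ω => Y y.1 y.2) =
        (Prod.fst ⁻¹' Icc a b).indicator fun y : ℝ × Ω => Z y.1 y.2 := by
      ext1 y; simp only [hY, indicator, mem_preimage]
    rw [this]
    exact hZ.indicator (measurable_fst measurableSet_Icc)
  have hYw : ∀ᵐ ω ∂μ, ∀ s, ‖Y s ω‖ ≤ ‖w ω‖ := by
    filter_upwards [hZw] with ω hω s
    by_cases hs : s ∈ Icc a b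
    · simp only [hY, indicator_of_mem hs]; exact (hω s hs).trans (le_abs_self _)
    · simp [hY, indicator_of_notMem hs]
  have hYs : ∀ s, Measurable (Y s) := fun s => hYm.comp (measurable_const.prodMk measurable_id)
  have hY2 : ∀ s, MemLp (Y s) 2 μ := fun s => hw.of_le (hYs s).aestronglyMeasurable
    (hYw.mono fun ω h => h s)
  have hYZ : ∀ s ∈ Icc a b, Z s = Y s := fun s hs => by
    ext1 ω; simp only [hY, indicator_of_mem hs]
  have hzY : ∀ᵐ ω ∂μ, ∀ t ∈ Icc a b, z t ω = z a ω + ∫ s in a..t, Y s ω := by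
    filter_upwards [hz] with ω h t ht
    rw [h t ht]
    congr 1
    refine intervalIntegral.integral_congr fun s hs => ?_
    rw [uIcc_of_le ht.1] at hs
    exact congrFun (hYZ s ⟨hs.1, hs.2.trans ht.2⟩) ω
  have hint : ∀ t ∈ Icc a b, MemLp (fun ω => ∫ s in a..t, Y s ω) 2 μ := by
    intro t ht
    refine (hw.const_mul (t - a)).of_le ?_ ?_
    · simp only [intervalIntegral.integral_of_le ht.1]
      exact (hYm.stronglyMeasurable.integral_prod_left'
        (μ := volume.restrict (Ioc a t))).aestronglyMeasurable
    · filter_upwards [hYw] with ω h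
      have := intervalIntegral.norm_integral_le_of_norm_le_const (a := a) (b := t)
        (f := fun s => Y s ω) (C := ‖w ω‖) fun s _ => h s
      rw [norm_mul, Real.norm_eq_abs (t - a)]
      linarith
  have hzt : ∀ t ∈ Icc a b, z t =ᵐ[μ] fun ω => z a ω + ∫ s in a..t, Y s ω := fun t ht =>
    hzY.mono fun ω h => h t ht
  have hzm : ∀ t ∈ Icc a b, MemLp (z t) 2 μ := fun t ht =>
    (memLp_congr_ae (hzt t ht)).2 (hza.add (hint t ht))
  refine ⟨hzm, ?_⟩
  have hYLm : StronglyMeasurable fun s => toLpClass 2 μ (Y s) :=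
    stronglyMeasurable_toLpClass hYm hY2
  have hYLi : ∀ s t, IntervalIntegrable (fun s => toLpClass 2 μ (Y s)) volume s t := fun s t =>
    IntervalIntegrable.mono_fun' (g := fun _ => 1 * ‖toLpClass 2 μ w‖) (by simp)
      hYLm.aestronglyMeasurable (Eventually.of_forall fun s =>
        norm_toLpClass_le hw (hYs s).aestronglyMeasurable
          (hYw.mono fun ω h => by simpa using h s))
  have main : HasW11Deriv a b (fun t => toLpClass 2 μ (z t)) (fun t => toLpClass 2 μ (Y t)) := by
    refine ⟨hYLi a b, fun t ht => ?_⟩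
    dsimp only
    rw [toLpClass_congr (hzt t ht), ← toLpClass_add hza (hint t ht)]
    congr 1
    -- Tested against `h`, the claim that the Bochner integral in `L²` is the class of the pointwise
    -- integrals becomes an exchange of integrals over `Ω` and time.
    refine ext_inner_left ℝ fun h => ?_
    have h1 : inner ℝ h (∫ s in a..t, toLpClass 2 μ (Y s)) =
        ∫ s in a..t, inner ℝ h (toLpClass 2 μ (Y s)) := by
      have := (innerSL ℝ h).intervalIntegral_comp_comm (hYLi a t)
      simpa using this.symm
    rw [h1, inner_toLpClass h (hint t ht)]
    simp only [inner_toLpClass h (hY2 _)]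
    have hprod : Integrable (fun y : Ω × ℝ => (inner ℝ (h y.1) (Y y.2 y.1) : ℝ))
        (μ.prod (volume.restrict (Ioc a t))) := by
      have hh : Measurable h := (Lp.stronglyMeasurable h).measurable
      have hm : Measurable fun y : Ω × ℝ => (inner ℝ (h y.1) (Y y.2 y.1) : ℝ) :=
        (hh.comp measurable_fst).inner (hYm.comp measurable_swap)
      have hb : Integrable (fun y : Ω × ℝ => ‖h y.1‖ * ‖w y.1‖ * (1 : ℝ))
          (μ.prod (volume.restrict (Ioc a t))) :=
        Integrable.mul_prod (f := fun ω => ‖h ω‖ * ‖w ω‖) (g := fun _ => (1 : ℝ))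
          ((Lp.memLp h).norm.integrable_mul hw.norm) (by simp)
      refine hb.mono hm.aestronglyMeasurable ?_
      have := Measure.quasiMeasurePreserving_fst
        (μ := μ) (ν := volume.restrict (Ioc a t)) |>.ae hYw
      filter_upwards [this] with y hy
      rw [mul_one, norm_mul, norm_norm, norm_norm]
      exact (norm_inner_le_norm _ _).trans (mul_le_mul_of_nonneg_left (hy y.2) (norm_nonneg _))
    have h2 : ∀ᵐ ω ∂μ, inner ℝ (h ω) (∫ s in a..t, Y s ω) =
        ∫ s in a..t, inner ℝ (h ω) (Y s ω) := by
      filter_upwards [hYw] with ω hω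
      have hi : IntervalIntegrable (fun s => Y s ω) volume a t :=
        IntervalIntegrable.mono_fun' (g := fun _ => ‖w ω‖) (by simp)
          (hYm.comp (measurable_id.prodMk measurable_const)).aestronglyMeasurable
          (Eventually.of_forall fun s => hω s)
      have := (innerSL ℝ (h ω)).intervalIntegral_comp_comm hi
      simpa using this.symm
    rw [integral_congr_ae h2]
    simp only [intervalIntegral.integral_of_le ht.1]
    exact integral_integral_swap hprod
  refine main.congr hab (fun _ _ => rfl) ?_
  filter_upwards [ae_restrict_mem measurableSet_Icc] with s hs
  rw [hYZ s hs]

end L2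

/-! ### Linear equations in a separable Hilbert space -/

section Linear

variable {H : Type*} [NormedAddCommGroup H] [InnerProductSpace ℝ H]

/-- `A` agrees almost everywhere on `[a,b]` with a strongly measurable and bounded field of
operators. -/
def IsBoundedField (A : ℝ → H →L[ℝ] H) (a b : ℝ) : Prop :=
  ∃ (B : ℝ → H →L[ℝ] H) (K : ℝ), 0 < K ∧ (∀ ψ, StronglyMeasurable fun t => B t ψ) ∧
    (∀ t, ‖B t‖ ≤ K) ∧ ∀ᵐ t ∂volume.restrict (Icc a b), A t = B t

theorem isCaratheodory_clm {B : ℝ → H →L[ℝ] H} {K : ℝ} (hK : 0 < K)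
    (hB : ∀ ψ, StronglyMeasurable fun t => B t ψ) (hBK : ∀ t, ‖B t‖ ≤ K) :
    IsCaratheodory (fun t ψ => B t ψ) K 0 where
  pos := hK
  meas := hB
  lip t x y := by rw [← map_sub]; exact (B t).le_of_opNorm_le (hBK t) _
  bound t := by simp

variable [CompleteSpace H]

/-- Duality between the linear equation and the backward adjoint equation. -/
theorem HasW11Deriv.eq_adjoint_apply {A : ℝ → H →L[ℝ] H} {a b : ℝ} {G : ℝ → ℝ → H →L[ℝ] H}
    (hG : IsEvolutionOperator A a b G) {p : ℝ → H}
    (hp : HasW11Deriv a b p fun t => -(ContinuousLinearMap.adjoint (A t)) (p t)) {t : ℝ}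
    (ht : t ∈ Icc a b) : p t = ContinuousLinearMap.adjoint (G b t) (p b) := by
  refine ext_inner_right ℝ fun ψ => ?_
  -- The pairing of `p` with `G(·,t) ψ` has zero derivative; comparing its values at `t` and `b`
  -- gives the identity.
  have h1 := HasW11Deriv.inner_sub_inner ht.2 (hp.mono ht ⟨ht.1.trans ht.2, le_rfl⟩)
    ((hG t ht).2 ψ)
  simp only [inner_neg_left, ContinuousLinearMap.adjoint_inner_left, neg_add_cancel,
    intervalIntegral.integral_zero, (hG t ht).1, ContinuousLinearMap.id_apply] at h1
  rw [ContinuousLinearMap.adjoint_inner_left]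
  linarith

variable [SecondCountableTopology H]

/-- The Picard solution from time `t` depends additively and homogeneously on its initial value by
uniqueness, and boundedly by Grönwall. -/
theorem exists_isEvolutionOperator {A : ℝ → H →L[ℝ] H} {a b : ℝ} (hA : IsBoundedField A a b) :
    ∃ G, IsEvolutionOperator A a b G := by
  obtain ⟨B, K, hK, hBm, hBK, hAB⟩ := hA
  have hF := isCaratheodory_clm hK hBm hBK
  set y : ℝ → H → ℝ → H := fun t ψ => picardSol (fun s χ => B s χ) t ψ with hy
  have hyW : ∀ t s ψ, HasW11Deriv t s (y t ψ) fun r => B r (y t ψ r) := fun t s ψ =>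
    hF.hasW11Deriv_picardSol t s ψ
  have hy0 : ∀ t ψ, y t ψ t = ψ := fun t ψ => hF.picardSol_self t ψ
  have hmax : ∀ t ψ s, y t ψ (max t s) = y t ψ s := fun t ψ s => picardSol_max _ _ _
  -- Working up to `max t s` covers `s < t` as well, where the solution is frozen, so `G s t` is a
  -- bounded operator for every pair of times.
  have huniq : ∀ t s (w : ℝ → H), HasW11Deriv t (max t s) w (fun r => B r (w r)) → w t = 0 →
      w (max t s) = 0 := fun t s w hw hw0 =>
    hw.eqOn_zero hK.le hw0 (Eventually.of_forall fun r => (B r).le_of_opNorm_le (hBK r) _) _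
      ⟨le_max_left _ _, le_rfl⟩
  have hadd : ∀ t s ψ χ, y t (ψ + χ) s = y t ψ s + y t χ s := fun t s ψ χ => by
    have h := ((hyW t (max t s) (ψ + χ)).sub (hyW t (max t s) ψ)).sub (hyW t (max t s) χ)
    simp only [← map_sub] at h
    have := huniq t s _ h (by simp [hy0])
    simp only [hmax, sub_sub, sub_eq_zero] at this
    exact this
  have hsmul : ∀ t s (c : ℝ) ψ, y t (c • ψ) s = c • y t ψ s := fun t s c ψ => by
    have h := (hyW t (max t s) (c • ψ)).sub ((hyW t (max t s) ψ).const_smul c)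
    simp only [← map_smul, ← map_sub] at h
    have := huniq t s _ h (by simp [hy0])
    simp only [hmax, sub_eq_zero] at this
    exact this
  have hbd : ∀ t s ψ, ‖y t ψ s‖ ≤ Real.exp (K * (max t s - t)) * ‖ψ‖ := fun t s ψ => by
    have := (hyW t (max t s) ψ).norm_le hK.le (e := fun _ => 0) (by simp) (fun _ => le_rfl)
      (Eventually.of_forall fun r => by simpa using (B r).le_of_opNorm_le (hBK r) _) (max t s)
      ⟨le_max_left _ _, le_rfl⟩
    rw [hmax, hy0] at this
    simpa [mul_comm] using this
  refine ⟨fun s t => LinearMap.mkContinuous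
    { toFun := fun ψ => y t ψ s, map_add' := hadd t s, map_smul' := hsmul t s } _ (hbd t s),
    fun t ht => ⟨?_, fun ψ => ?_⟩⟩
  · ext1 ψ
    exact hy0 t ψ
  · refine (hyW t b ψ).congr ht.2 (fun _ _ => rfl) ?_
    have : ∀ᵐ r ∂volume.restrict (Icc t b), A r = B r :=
      ae_mono (Measure.restrict_mono (Icc_subset_Icc_left ht.1) le_rfl) hAB
    filter_upwards [this] with r hr
    rw [hr]
    rfl

/-- Time reversal `s ↦ a + b - s` turns the backward equation into a forward one. Taking adjoints
preserves the norm bound; it preserves strong measurability because weak measurability suffices in a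
separable space. -/
theorem exists_backward_solution {A : ℝ → H →L[ℝ] H} {a b : ℝ} (hab : a ≤ b)
    (hA : IsBoundedField A a b) (q : H) :
    ∃ p : ℝ → H, HasW11Deriv a b p (fun t => -(ContinuousLinearMap.adjoint (A t)) (p t)) ∧
      p b = q := by
  obtain ⟨B, K, hK, hBm, hBK, hAB⟩ := hA
  borelize H
  have hm : ∀ ψ, Measurable fun t => ContinuousLinearMap.adjoint (B t) ψ := fun ψ =>
    measurable_of_measurable_inner fun h => by
      simp only [ContinuousLinearMap.adjoint_inner_right]
      exact ((hBm h).inner stronglyMeasurable_const).measurable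
  have hF := isCaratheodory_clm (B := fun s => ContinuousLinearMap.adjoint (B (a + b - s))) hK
    (fun ψ => ((hm ψ).comp (measurable_const.sub measurable_id)).stronglyMeasurable)
    (fun t => by rw [LinearIsometryEquiv.norm_map]; exact hBK _)
  set F : ℝ → H → H := fun s ψ => ContinuousLinearMap.adjoint (B (a + b - s)) ψ with hFdef
  set y := picardSol F a q with hy
  have hyW : HasW11Deriv a b y fun s => F s (y s) := hF.hasW11Deriv_picardSol a b q
  refine ⟨fun t => y (a + b - t), ?_, by simpa using hF.picardSol_self a q⟩
  have key : HasW11Deriv a b (fun t => y (a + b - t))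
      fun t => -(ContinuousLinearMap.adjoint (B t)) (y (a + b - t)) := by
    refine ⟨?_, fun t ht => ?_⟩
    · have := (hyW.1.comp_sub_left (a + b)).symm
      simp only [hFdef, sub_sub_cancel, add_sub_cancel_left, add_sub_cancel_right] at this
      exact this.neg
    · have h1 := hyW.sub_eq (s := a + b - t) (t := b) ⟨by linarith [ht.2], by linarith [ht.1]⟩
        ⟨hab, le_rfl⟩
      have h2 := intervalIntegral.integral_comp_sub_left (a := a) (b := t)
        (fun s => F s (y s)) (a + b)
      simp only [hFdef, sub_sub_cancel, add_sub_cancel_left] at h1 h2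
      rw [intervalIntegral.integral_neg, h2, ← h1]
      simp
  refine key.congr hab (fun _ _ => rfl) ?_
  filter_upwards [hAB] with t ht
  rw [ht]

end Linear

/-! ### The ensemble dynamics -/

theorem dyn_sub_control {Ω : Type*} {n m : ℕ} (f : Fin (m + 1) → Vec n → Ω → Vec n) (x : Vec n)
    (u v : Vec m) (ω : Ω) :
    dyn f x u ω - dyn f x v ω = ∑ i, (u - v) i • f i.succ x ω := by
  simp only [dyn, add_sub_add_left_eq_sub, ← Finset.sum_sub_distrib, ← sub_smul, PiLp.sub_apply]

section Dyn

variable {Ω : Type*} [MeasurableSpace Ω] {n m : ℕ}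

/-- Uniform linear growth and Lipschitz bounds for the vector fields, with measurability in the
parameter. -/
structure IsLipDyn (f : Fin (m + 1) → Vec n → Ω → Vec n) (C : ℝ) : Prop where
  pos : 0 < C
  meas : ∀ i x, Measurable (f i x)
  growth : ∀ i x ω, ‖f i x ω‖ ≤ C * (1 + ‖x‖)
  lip : ∀ i x x' ω, ‖f i x ω - f i x' ω‖ ≤ C * ‖x - x'‖

theorem H0.exists_isLipDyn {f : Fin (m + 1) → Vec n → Ω → Vec n} {g : Vec n → Ω → ℝ}
    {U : ℝ → Set (Vec m)} {t₀ T : ℝ} (h0 : H0 f g U t₀ T) :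
    ∃ C, IsLipDyn f C ∧ ∀ t ∈ Icc t₀ T, ∀ u ∈ U t, ‖u‖ ≤ C := by
  choose c hc0 hc using h0.f_growth
  choose k hk0 hk using h0.f_lipschitz
  obtain ⟨S, hS, hUS⟩ := h0.U_bounded
  obtain ⟨R, hR⟩ := hS.isBounded.exists_norm_le
  have hci : ∀ i, c i ≤ ∑ j, c j := fun i =>
    Finset.single_le_sum (f := c) (fun j _ => (hc0 j).le) (Finset.mem_univ i)
  have hki : ∀ i, k i ≤ ∑ j, k j := fun i =>
    Finset.single_le_sum (f := k) (fun j _ => (hk0 j).le) (Finset.mem_univ i)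
  have hcs : 0 < ∑ j, c j := (hc0 0).trans_le (hci 0)
  have hks : 0 < ∑ j, k j := (hk0 0).trans_le (hki 0)
  refine ⟨(∑ j, c j) + (∑ j, k j) + |R|, ⟨by positivity, h0.f_measurable, ?_, ?_⟩, ?_⟩
  · intro i x ω
    refine (hc i x ω).trans (mul_le_mul_of_nonneg_right ?_ (by positivity))
    linarith [hci i, abs_nonneg R]
  · intro i x x' ω
    refine (hk i x x' ω).trans (mul_le_mul_of_nonneg_right ?_ (by positivity))
    linarith [hki i, abs_nonneg R]
  · intro t ht u hu
    linarith [hR u (hUS t ht hu), le_abs_self R]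

variable {f : Fin (m + 1) → Vec n → Ω → Vec n} {C : ℝ}

theorem abs_coord_le_norm (u : Vec m) (i : Fin m) : |u i| ≤ ‖u‖ := by
  simpa using PiLp.norm_apply_le u i

theorem norm_sum_smul_le (u : Vec m) (z : Fin m → Vec n) {c : ℝ} (hz : ∀ i, ‖z i‖ ≤ c) :
    ‖∑ i, u i • z i‖ ≤ m * ‖u‖ * c := by
  refine (norm_sum_le _ _).trans ?_
  have : ∀ i ∈ Finset.univ, ‖u i • z i‖ ≤ ‖u‖ * c := fun i _ => by
    rw [norm_smul]
    exact mul_le_mul (abs_coord_le_norm u i) (hz i) (norm_nonneg _) (norm_nonneg _)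
  refine (Finset.sum_le_sum this).trans_eq ?_
  simp [mul_assoc]

theorem IsLipDyn.dyn_growth (hf : IsLipDyn f C) (x : Vec n) (u : Vec m) (ω : Ω) :
    ‖dyn f x u ω‖ ≤ C * (1 + m * ‖u‖) * (1 + ‖x‖) := by
  refine (norm_add_le _ _).trans ?_
  have h1 := hf.growth 0 x ω
  have h2 := norm_sum_smul_le u (fun i => f i.succ x ω) fun i => hf.growth i.succ x ω
  linarith

theorem IsLipDyn.dyn_lip (hf : IsLipDyn f C) (x y : Vec n) (u : Vec m) (ω : Ω) :
    ‖dyn f x u ω - dyn f y u ω‖ ≤ C * (1 + m * ‖u‖) * ‖x - y‖ := by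
  have e : dyn f x u ω - dyn f y u ω =
      (f 0 x ω - f 0 y ω) + ∑ i : Fin m, u i • (f i.succ x ω - f i.succ y ω) := by
    simp only [dyn, smul_sub, Finset.sum_sub_distrib]
    abel
  rw [e]
  refine (norm_add_le _ _).trans ?_
  have h1 := hf.lip 0 x y ω
  have h2 := norm_sum_smul_le u (fun i => f i.succ x ω - f i.succ y ω)
    fun i => hf.lip i.succ x y ω
  linarith

theorem IsLipDyn.dyn_control_lip (hf : IsLipDyn f C) (x : Vec n) (u v : Vec m) (ω : Ω) :
    ‖dyn f x u ω - dyn f x v ω‖ ≤ m * ‖u - v‖ * (C * (1 + ‖x‖)) := by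
  rw [dyn_sub_control]
  exact norm_sum_smul_le _ _ fun i => hf.growth i.succ x ω

theorem IsLipDyn.continuous (hf : IsLipDyn f C) (i : Fin (m + 1)) (ω : Ω) :
    Continuous fun x => f i x ω :=
  (LipschitzWith.of_dist_le_mul (K := C.toNNReal) fun x y => by
    rw [dist_eq_norm, dist_eq_norm, Real.coe_toNNReal C hf.pos.le]
    exact hf.lip i x y ω).continuous

theorem IsLipDyn.continuous_dyn (hf : IsLipDyn f C) (u : Vec m) (ω : Ω) :
    Continuous fun x => dyn f x u ω :=
  (hf.continuous 0 ω).add (continuous_finsetSum _ fun i _ => 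
    (hf.continuous i.succ ω).fun_const_smul _)

theorem IsLipDyn.norm_dynJac_le (hf : IsLipDyn f C) (x : Vec n) (u : Vec m) (ω : Ω) :
    ‖dynJac f x u ω‖ ≤ C * (1 + m * ‖u‖) := by
  have := hf.pos
  exact norm_fderiv_le_of_lip' ℝ (by positivity) (Eventually.of_forall fun y => hf.dyn_lip y x u ω)

theorem IsLipDyn.measurable_comp (hf : IsLipDyn f C) (i : Fin (m + 1)) {α : Type*}
    [MeasurableSpace α] {x : α → Vec n} {w : α → Ω} (hx : Measurable x) (hw : Measurable w) :
    Measurable fun a => f i (x a) (w a) :=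
  (measurable_uncurry_of_continuous_of_measurable (u := fun x ω => f i x ω) (hf.continuous i)
    (hf.meas i)).comp (hx.prodMk hw)

theorem IsLipDyn.measurable_dyn (hf : IsLipDyn f C) {α : Type*} [MeasurableSpace α]
    {x : α → Vec n} {u : α → Vec m} {w : α → Ω} (hx : Measurable x) (hu : Measurable u)
    (hw : Measurable w) : Measurable fun a => dyn f (x a) (u a) (w a) := by
  refine (hf.measurable_comp 0 hx hw).add (Finset.measurable_sum _ fun i _ => ?_)
  have : Measurable fun a => u a i := by fun_prop
  exact this.smul (hf.measurable_comp i.succ hx hw)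

theorem IsLipDyn.measurable_dynJac (hf : IsLipDyn f C) {α : Type*} [MeasurableSpace α]
    {x : α → Vec n} {u : α → Vec m} {w : α → Ω} (hx : Measurable x) (hu : Measurable u)
    (hw : Measurable w) : Measurable fun a => dynJac f (x a) (u a) (w a) := by
  have := measurable_fderiv_of_caratheodory
    (f := fun (z : Vec m × Ω) (x : Vec n) => dyn f x z.1 z.2)
    (fun z => hf.continuous_dyn z.1 z.2)
    (fun x => hf.measurable_dyn measurable_const measurable_fst measurable_snd)
  exact this.comp ((hu.prodMk hw).prodMk hx)

theorem measurable_gradient_of_caratheodory {α : Type*} [MeasurableSpace α]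
    {g : Vec n → Ω → ℝ} (hg : Measurable fun z : Vec n × Ω => g z.1 z.2)
    (hc : ∀ ω, Continuous fun x => g x ω) {x : α → Vec n} {w : α → Ω} (hx : Measurable x)
    (hw : Measurable w) : Measurable fun a => gradient (fun z => g z (w a)) (x a) := by
  have := measurable_fderiv_of_caratheodory (f := fun ω x => g x ω) hc
    (fun x => hg.comp (measurable_const.prodMk measurable_id))
  have h2 := this.comp (hw.prodMk hx)
  exact (InnerProductSpace.toDual ℝ (Vec n)).symm.continuous.measurable.comp h2

/-! ### The linearised operator -/

variable {μ : Measure Ω}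

theorem IsLipDyn.memLp_dynJac (hf : IsLipDyn f C) {x : Ω → Vec n} (hx : AEMeasurable x μ)
    (u : Vec m) : MemLp (fun ω => dynJac f (x ω) u ω) ∞ μ := by
  refine memLp_top_of_bound ?_ (C * (1 + m * ‖u‖)) (Eventually.of_forall fun ω =>
    hf.norm_dynJac_le _ _ _)
  have h1 : Measurable fun ω => dynJac f (hx.mk x ω) u ω :=
    hf.measurable_dynJac hx.measurable_mk measurable_const measurable_id
  refine (h1.aemeasurable.congr ?_).aestronglyMeasurable
  filter_upwards [hx.ae_eq_mk] with ω h
  rw [h]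

theorem memLp_one_add_norm {F : Type*} [NormedAddCommGroup F] [IsFiniteMeasure μ] {x : Ω → F}
    (hx : MemLp x 2 μ) : MemLp (fun ω => 1 + ‖x ω‖) 2 μ :=
  (memLp_const (1 : ℝ)).add hx.norm

theorem IsLipDyn.memLp_dyn [IsFiniteMeasure μ] (hf : IsLipDyn f C) {x : Ω → Vec n}
    (hx : MemLp x 2 μ) (u : Vec m) : MemLp (fun ω => dyn f (x ω) u ω) 2 μ := by
  have h1 : MemLp (fun ω => C * (1 + m * ‖u‖) * (1 + ‖x ω‖)) 2 μ := (memLp_one_add_norm hx).const_mul _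
  have hxm := hx.1.aemeasurable
  refine h1.of_le ?_ (Eventually.of_forall fun ω => (hf.dyn_growth _ _ _).trans (le_abs_self _))
  have h1 : Measurable fun ω => dyn f (hxm.mk x ω) u ω :=
    hf.measurable_dyn hxm.measurable_mk measurable_const measurable_id
  refine (h1.aemeasurable.congr ?_).aestronglyMeasurable
  filter_upwards [hxm.ae_eq_mk] with ω h
  rw [h]

theorem IsLipDyn.memLp_field [IsFiniteMeasure μ] (hf : IsLipDyn f C) (i : Fin (m + 1))
    {x : Ω → Vec n} (hx : MemLp x 2 μ) : MemLp (fun ω => f i (x ω) ω) 2 μ := by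
  have h1 : MemLp (fun ω => C * (1 + ‖x ω‖)) 2 μ := (memLp_one_add_norm hx).const_mul _
  have hxm := hx.1.aemeasurable
  refine h1.of_le ?_ (Eventually.of_forall fun ω => (hf.growth _ _ _).trans (le_abs_self _))
  have h1 : Measurable fun ω => f i (hxm.mk x ω) ω :=
    hf.measurable_comp i hxm.measurable_mk measurable_id
  refine (h1.aemeasurable.congr ?_).aestronglyMeasurable
  filter_upwards [hxm.ae_eq_mk] with ω h
  rw [h]

theorem IsLipDyn.coeFn_linOp (hf : IsLipDyn f C) {x : Ω → Vec n} (hx : AEMeasurable x μ)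
    (u : Vec m) (ψ : Lp (Vec n) 2 μ) :
    linOp μ f x u ψ =ᵐ[μ] fun ω => dynJac f (x ω) u ω (ψ ω) := by
  have h := (ContinuousLinearMap.id ℝ (Vec n →L[ℝ] Vec n)).coeFn_holder (r := 2)
    (toLpClass ∞ μ (fun ω => dynJac f (x ω) u ω)) ψ
  filter_upwards [h, coeFn_toLpClass (hf.memLp_dynJac hx u)] with ω h1 h2
  rw [linOp, ContinuousLinearMap.holderL_apply_apply, h1, h2]
  rfl

theorem IsLipDyn.norm_linOp_le (hf : IsLipDyn f C) {x : Ω → Vec n} (hx : AEMeasurable x μ)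
    (u : Vec m) : ‖linOp μ f x u‖ ≤ C * (1 + m * ‖u‖) := by
  have := hf.pos
  refine ContinuousLinearMap.opNorm_le_bound _ (by positivity) fun ψ => ?_
  refine Lp.norm_le_mul_norm_of_ae_le_mul ?_
  filter_upwards [hf.coeFn_linOp hx u ψ] with ω h
  rw [h]
  exact (dynJac f (x ω) u ω).le_of_opNorm_le (hf.norm_dynJac_le _ _ _) _

theorem linOp_congr (f : Fin (m + 1) → Vec n → Ω → Vec n) {x y : Ω → Vec n} (h : x =ᵐ[μ] y)
    (u : Vec m) : linOp μ f x u = linOp μ f y u := by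
  rw [linOp, linOp, toLpClass_congr]
  filter_upwards [h] with ω hω
  rw [hω]

theorem dynL2_congr (f : Fin (m + 1) → Vec n → Ω → Vec n) {x y : Ω → Vec n} (h : x =ᵐ[μ] y)
    (u : Vec m) : dynL2 μ f x u = dynL2 μ f y u := by
  refine toLpClass_congr ?_
  filter_upwards [h] with ω hω
  rw [hω]

/-- Along a jointly measurable arc, the linearised operators form a bounded field. -/
theorem IsLipDyn.isBoundedField_linOp [SFinite μ] [IsSeparable μ] (hf : IsLipDyn f C) {a b R : ℝ}
    {x z : ℝ → Ω → Vec n} {u v : ℝ → Vec m} (hz : Measurable fun y : ℝ × Ω => z y.1 y.2)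
    (hv : Measurable v) (hvR : ∀ t, ‖v t‖ ≤ R)
    (hxz : ∀ t ∈ Icc a b, x t =ᵐ[μ] z t) (huv : ∀ᵐ t ∂volume.restrict (Icc a b), u t = v t) :
    IsBoundedField (fun t => linOp μ f (x t) (u t)) a b := by
  have hC := hf.pos
  have hzt : ∀ t, Measurable (z t) := fun t => hz.comp (measurable_const.prodMk measurable_id)
  have hR : 0 ≤ R := (norm_nonneg _).trans (hvR 0)
  refine ⟨fun t => linOp μ f (z t) (v t), C * (1 + m * R), by positivity, fun ψ => ?_,
    fun t => ?_, ?_⟩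
  · have hJm : Measurable fun y : ℝ × Ω => dynJac f (z y.1 y.2) (v y.1) y.2 :=
      hf.measurable_dynJac hz (hv.comp measurable_fst) measurable_snd
    have hψ : Measurable ψ := (Lp.stronglyMeasurable ψ).measurable
    have hm : Measurable fun y : ℝ × Ω => dynJac f (z y.1 y.2) (v y.1) y.2 (ψ y.2) :=
      (isBoundedBilinearMap_apply (𝕜 := ℝ) (E := Vec n) (F := Vec n)).continuous.measurable.comp
        (hJm.prodMk (hψ.comp measurable_snd))
    have hmem : ∀ t, MemLp (fun ω => dynJac f (z t ω) (v t) ω (ψ ω)) 2 μ := fun t =>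
      (memLp_congr_ae (hf.coeFn_linOp (hzt t).aemeasurable (v t) ψ)).1 (Lp.memLp _)
    have := stronglyMeasurable_toLpClass hm hmem
    have e : (fun t => linOp μ f (z t) (v t) ψ) =
        fun t => toLpClass 2 μ fun ω => dynJac f (z t ω) (v t) ω (ψ ω) := funext fun t =>
      Lp.ext ((hf.coeFn_linOp (hzt t).aemeasurable (v t) ψ).trans (coeFn_toLpClass (hmem t)).symm)
    rw [e]
    exact this
  · refine (hf.norm_linOp_le (hzt t).aemeasurable (v t)).trans ?_
    gcongr
    exact hvR t
  · filter_upwards [huv, ae_restrict_mem measurableSet_Icc] with t h1 h2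
    rw [h1, linOp_congr f (hxz t h2)]

end Dyn

/-! ### Trajectories -/

section Trajectories

variable {Ω : Type*} [MeasurableSpace Ω] {n m : ℕ} {f : Fin (m + 1) → Vec n → Ω → Vec n} {C R : ℝ}
  {t₀ T : ℝ}

/-- The trajectory of the dynamics with control `v` and parameter `ω` starting at `ξ`. -/
noncomputable def traj {Ω : Type*} {n m : ℕ} (f : Fin (m + 1) → Vec n → Ω → Vec n) (t₀ : ℝ)
    (v : ℝ → Vec m) (ξ : Vec n) (t : ℝ) (ω : Ω) : Vec n :=
  picardSol (fun s y => dyn f y (v s) ω) t₀ ξ t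

theorem IsLipDyn.mul_le (hf : IsLipDyn f C) {u : Vec m} (hu : ‖u‖ ≤ R) :
    C * (1 + m * ‖u‖) ≤ C * (1 + m * R) := by
  have := hf.pos
  gcongr

theorem IsLipDyn.rate_pos (hf : IsLipDyn f C) (hR : 0 ≤ R) : 0 < C * (1 + m * R) := by
  have := hf.pos
  positivity

theorem IsLipDyn.isCaratheodory (hf : IsLipDyn f C) {v : ℝ → Vec m} (hv : Measurable v)
    (hvR : ∀ t, ‖v t‖ ≤ R) (ω : Ω) :
    IsCaratheodory (fun s y => dyn f y (v s) ω) (C * (1 + m * R)) (C * (1 + m * R)) where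
  pos := hf.rate_pos ((norm_nonneg _).trans (hvR 0))
  meas x := (hf.measurable_dyn measurable_const hv measurable_const).stronglyMeasurable
  lip t x y := (hf.dyn_lip x y (v t) ω).trans
    (mul_le_mul_of_nonneg_right (hf.mul_le (hvR t)) (norm_nonneg _))
  bound t := by
    have := hf.dyn_growth 0 (v t) ω
    rw [norm_zero, add_zero, mul_one] at this
    exact this.trans (hf.mul_le (hvR t))

theorem IsLipDyn.continuous_traj (hf : IsLipDyn f C) {v : ℝ → Vec m} (hv : Measurable v)
    (hvR : ∀ t, ‖v t‖ ≤ R) (ξ : Vec n) (ω : Ω) : Continuous fun t => traj f t₀ v ξ t ω :=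
  (hf.isCaratheodory hv hvR ω).continuous_picardSol t₀ ξ

theorem IsLipDyn.traj_self (hf : IsLipDyn f C) {v : ℝ → Vec m} (hv : Measurable v)
    (hvR : ∀ t, ‖v t‖ ≤ R) (ξ : Vec n) (ω : Ω) : traj f t₀ v ξ t₀ ω = ξ :=
  (hf.isCaratheodory hv hvR ω).picardSol_self t₀ ξ

theorem IsLipDyn.hasW11Deriv_traj (hf : IsLipDyn f C) {v : ℝ → Vec m} (hv : Measurable v)
    (hvR : ∀ t, ‖v t‖ ≤ R) (ξ : Vec n) (ω : Ω) :
    HasW11Deriv t₀ T (fun t => traj f t₀ v ξ t ω) fun t => dyn f (traj f t₀ v ξ t ω) (v t) ω :=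
  (hf.isCaratheodory hv hvR ω).hasW11Deriv_picardSol t₀ T ξ

theorem IsLipDyn.measurable_traj (hf : IsLipDyn f C) {v : ℝ → Vec m} (hv : Measurable v)
    (hvR : ∀ t, ‖v t‖ ≤ R) {φ : Ω → Vec n} (hφ : Measurable φ) :
    Measurable fun z : ℝ × Ω => traj f t₀ v (φ z.2) z.1 z.2 :=
  measurable_picardSol (F := fun ω s y => dyn f y (v s) ω) (fun ω => hf.isCaratheodory hv hvR ω)
    (fun _ => hf.measurable_dyn measurable_const (hv.comp measurable_fst) measurable_snd) t₀ hφ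

/-- Replaces a given arc by the Picard solution for a Borel version of its control, from which joint
measurability in time and parameter follows. -/
theorem IsLipDyn.eq_traj (hf : IsLipDyn f C) {v u : ℝ → Vec m} (hv : Measurable v)
    (hvR : ∀ t, ‖v t‖ ≤ R) {ω : Ω} {x : ℝ → Vec n}
    (hx : HasW11Deriv t₀ T x fun t => dyn f (x t) (u t) ω)
    (huv : ∀ᵐ t ∂volume.restrict (Icc t₀ T), u t = v t) :
    ∀ t ∈ Icc t₀ T, x t = traj f t₀ v (x t₀) t ω := by
  intro t ht
  have h := hx.sub (hf.hasW11Deriv_traj (T := T) hv hvR (x t₀) ω)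
  refine sub_eq_zero.1 (h.eqOn_zero (hf.rate_pos ((norm_nonneg _).trans (hvR 0))).le ?_ ?_ t ht)
  · rw [hf.traj_self hv hvR, sub_self]
  · filter_upwards [huv] with s hs
    rw [hs]
    exact (hf.isCaratheodory hv hvR ω).lip s _ _

/-- Bounded measurable representatives of controls. -/
theorem exists_measurable_control (hR : 0 ≤ R) {U : ℝ → Set (Vec m)}
    (hU : ∀ t ∈ Icc t₀ T, ∀ u ∈ U t, ‖u‖ ≤ R) {u : ℝ → Vec m}
    (hu : AEStronglyMeasurable u (volume.restrict (Icc t₀ T)))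
    (huU : ∀ᵐ t ∂volume.restrict (Icc t₀ T), u t ∈ U t) :
    ∃ v : ℝ → Vec m, Measurable v ∧ (∀ t, ‖v t‖ ≤ R) ∧
      ∀ᵐ t ∂volume.restrict (Icc t₀ T), u t = v t := by
  classical
  have hm := hu.stronglyMeasurable_mk.measurable
  refine ⟨fun t => if ‖hu.mk u t‖ ≤ R then hu.mk u t else 0,
    Measurable.ite (measurableSet_le hm.norm measurable_const) hm measurable_const,
    fun t => ?_, ?_⟩
  · dsimp only
    split_ifs with h
    · exact h
    · simpa using hR
  · filter_upwards [hu.ae_eq_mk, huU, ae_restrict_mem measurableSet_Icc] with t h1 h2 h3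
    rw [← h1, if_pos (hU t h3 _ h2)]

/-- Grönwall, with a constant independent of control and parameter; this uniformity supplies the
square-integrable majorants used later. -/
theorem IsLipDyn.exists_arc_bound (hf : IsLipDyn f C) (hR : 0 ≤ R) (hT : t₀ ≤ T) :
    ∃ B, 0 ≤ B ∧ ∀ (u : ℝ → Vec m) (ω : Ω) (x : ℝ → Vec n),
      (∀ᵐ t ∂volume.restrict (Icc t₀ T), ‖u t‖ ≤ R) →
      HasW11Deriv t₀ T x (fun t => dyn f (x t) (u t) ω) →
      ∀ t ∈ Icc t₀ T, ‖x t‖ ≤ B * (1 + ‖x t₀‖) := by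
  set D := C * (1 + m * R) with hD
  have hD0 : 0 < D := hf.rate_pos hR
  have hT' : 0 ≤ T - t₀ := sub_nonneg.2 hT
  refine ⟨(1 + (T - t₀) * D) * Real.exp (D * (T - t₀)), by positivity, fun u ω x hu hx t ht => ?_⟩
  have h := hx.norm_le hD0.le (e := fun _ => D) (by simp) (fun _ => hD0.le)
    (by
      filter_upwards [hu] with s hs
      have h1 := hf.dyn_growth (x s) (u s) ω
      have h2 := mul_le_mul_of_nonneg_right (hf.mul_le hs) (show 0 ≤ 1 + ‖x s‖ by positivity)
      linarith) t ht
  refine h.trans ?_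
  rw [intervalIntegral.integral_const, smul_eq_mul, mul_right_comm (1 + (T - t₀) * D)]
  refine mul_le_mul_of_nonneg_right ?_ (Real.exp_pos _).le
  have := norm_nonneg (x t₀)
  have h3 : 0 ≤ (T - t₀) * D := by positivity
  nlinarith [mul_nonneg h3 this]

/-- Trajectories depend Lipschitz continuously on the control, in the `W^{1,∞}` sense. -/
theorem IsLipDyn.exists_arc_sub_bound (hf : IsLipDyn f C) (hR : 0 ≤ R) (hT : t₀ ≤ T) :
    ∃ L, 0 ≤ L ∧ ∀ (u v : ℝ → Vec m) (η : ℝ) (ω : Ω) (x y : ℝ → Vec n),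
      (∀ t, ‖u t‖ ≤ R) → (∀ t, ‖v t‖ ≤ R) → (∀ t, ‖u t - v t‖ ≤ η) →
      HasW11Deriv t₀ T x (fun t => dyn f (x t) (u t) ω) →
      HasW11Deriv t₀ T y (fun t => dyn f (y t) (v t) ω) → x t₀ = y t₀ →
      ∀ t ∈ Icc t₀ T, ‖x t - y t‖ ≤ η * (L * (1 + ‖x t₀‖)) ∧
        ‖dyn f (x t) (u t) ω - dyn f (y t) (v t) ω‖ ≤ η * (L * (1 + ‖x t₀‖)) := by
  obtain ⟨B, hB0, hB⟩ := hf.exists_arc_bound hR hT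
  set D := C * (1 + m * R) with hD
  have hD0 : 0 < D := hf.rate_pos hR
  have hC := hf.pos
  have hT' : 0 ≤ T - t₀ := sub_nonneg.2 hT
  set N := (T - t₀) * Real.exp (D * (T - t₀)) with hN
  have hN0 : 0 ≤ N := by positivity
  set M := m * (C * (1 + B)) with hM
  have hM0 : 0 ≤ M := by positivity
  -- `M * N` bounds the state difference by Grönwall, and `D * (M * N) + M` the velocity difference;
  -- their sum serves for both.
  refine ⟨M * N + (D * (M * N) + M), by positivity, fun u v η ω x y hu hv huv hx hy h0 => ?_⟩
  have hη : 0 ≤ η := (norm_nonneg _).trans (huv 0)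
  set W := 1 + ‖x t₀‖ with hW
  have hW1 : 1 ≤ W := by simp [hW]
  have hder : ∀ t ∈ Icc t₀ T, ‖dyn f (x t) (u t) ω - dyn f (y t) (v t) ω‖ ≤
      D * ‖x t - y t‖ + η * (M * W) := by
    intro t ht
    have h1 := hf.dyn_lip (x t) (y t) (u t) ω
    have h2 := mul_le_mul_of_nonneg_right (hf.mul_le (hu t)) (norm_nonneg (x t - y t))
    have h3 := hf.dyn_control_lip (y t) (u t) (v t) ω
    have h4 := hB v ω y (Eventually.of_forall hv) hy t ht
    rw [← h0] at h4
    have h5 : m * ‖u t - v t‖ * (C * (1 + ‖y t‖)) ≤ m * η * (C * (W + B * W)) := by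
      gcongr
      exact huv t
    have h6 : m * η * (C * (W + B * W)) = η * (M * W) := by rw [hM]; ring
    have h7 : dyn f (x t) (u t) ω - dyn f (y t) (v t) ω =
        (dyn f (x t) (u t) ω - dyn f (y t) (u t) ω) +
          (dyn f (y t) (u t) ω - dyn f (y t) (v t) ω) := by abel
    rw [h7]
    exact (norm_add_le _ _).trans (by linarith)
  have hst : ∀ t ∈ Icc t₀ T, ‖x t - y t‖ ≤ η * (M * N * W) := by
    intro t ht
    have h := (hx.sub hy).norm_le hD0.le (e := fun _ => η * (M * W)) (by simp)
      (fun _ => by positivity)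
      (by filter_upwards [ae_restrict_mem measurableSet_Icc] with s hs using hder s hs) t ht
    rw [h0, sub_self, norm_zero, zero_add, intervalIntegral.integral_const, smul_eq_mul] at h
    refine h.trans_eq ?_
    rw [hN]; ring
  intro t ht
  have h1 := hst t ht
  have h2 := hder t ht
  have h3 := mul_le_mul_of_nonneg_left h1 hD0.le
  have hMN : 0 ≤ η * (M * N * W) := by positivity
  have hDMN : 0 ≤ η * (D * (M * N) * W) := by positivity
  have hMW : 0 ≤ η * (M * W) := by positivity
  have e : η * ((M * N + (D * (M * N) + M)) * W) =
      η * (M * N * W) + (η * (D * (M * N) * W) + η * (M * W)) := by ring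
  rw [e]
  constructor
  · linarith
  · have e2 : D * (η * (M * N * W)) = η * (D * (M * N) * W) := by ring
    linarith

theorem dyn_convex_combination {Ω : Type*} {n m : ℕ} (f : Fin (m + 1) → Vec n → Ω → Vec n)
    (x : Vec n) (u v : Vec m) (c : ℝ) (ω : Ω) :
    dyn f x (u + c • (v - u)) ω = dyn f x u ω + c • (dyn f x v ω - dyn f x u ω) := by
  rw [← sub_eq_iff_eq_add', dyn_sub_control, dyn_sub_control, Finset.smul_sum]
  refine Finset.sum_congr rfl fun i _ => ?_
  simp [smul_smul]

/-- The first variation of a trajectory under a convex variation of the control. -/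
theorem IsLipDyn.tendsto_variation (hf : IsLipDyn f C) (hT : t₀ ≤ T) {u v : ℝ → Vec m}
    (hu : Measurable u) (hv : Measurable v) (huR : ∀ t, ‖u t‖ ≤ R) (hvR : ∀ t, ‖v t‖ ≤ R)
    {ω : Ω} {x y : ℝ → Vec n} {z : ℕ → ℝ → Vec n} {ε : ℕ → ℝ} {c : ℝ} (hε : ∀ k, 0 < ε k)
    (hε0 : Tendsto ε atTop (𝓝 0)) (hε1 : ∀ k, ε k ≤ 1) (hxm : Measurable x)
    (hzm : ∀ k, Measurable (z k))
    (hx : HasW11Deriv t₀ T x fun t => dyn f (x t) (u t) ω)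
    (hz : ∀ k, HasW11Deriv t₀ T (z k) fun t => dyn f (z k t) (u t + ε k • (v t - u t)) ω)
    (hz0 : ∀ k, z k t₀ = x t₀) (hzc : ∀ k, ∀ t ∈ Icc t₀ T, ‖z k t - x t‖ ≤ ε k * c)
    (hy : HasW11Deriv t₀ T y fun t => dynJac f (x t) (u t) ω (y t) +
      (dyn f (x t) (v t) ω - dyn f (x t) (u t) ω)) (hy0 : y t₀ = 0)
    (hd : ∀ᵐ t ∂volume.restrict (Icc t₀ T),
      DifferentiableAt ℝ (fun ξ => dyn f ξ (u t) ω) (x t)) :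
    Tendsto (fun k => (ε k)⁻¹ • (z k T - x T)) atTop (𝓝 (y T)) := by
  have hR : 0 ≤ R := (norm_nonneg _).trans (huR 0)
  set D := C * (1 + m * R) with hD
  have hD0 : 0 < D := hf.rate_pos hR
  have hc : 0 ≤ c := by
    have := (norm_nonneg _).trans (hzc 0 t₀ ⟨le_rfl, hT⟩)
    exact nonneg_of_mul_nonneg_right this (hε 0)
  have hlip : ∀ (w : ℝ → Vec m), (∀ t, ‖w t‖ ≤ R) → ∀ t a b,
      ‖dyn f a (w t) ω - dyn f b (w t) ω‖ ≤ D * ‖a - b‖ := fun w hw t a b =>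
    (hf.dyn_lip a b (w t) ω).trans (mul_le_mul_of_nonneg_right (hf.mul_le (hw t)) (norm_nonneg _))
  have hJ : ∀ t (a : Vec n), ‖dynJac f (x t) (u t) ω a‖ ≤ D * ‖a‖ := fun t a =>
    (dynJac f (x t) (u t) ω).le_of_opNorm_le
      ((hf.norm_dynJac_le _ _ _).trans (hf.mul_le (huR t))) a
  -- `r` is the rescaled Taylor remainder in the state, bounded by the Lipschitz constant and
  -- vanishing by differentiability. `s` is the mixed state–control increment, of order `ε`.
  -- Together they are the defect of the difference quotient in the linearised equation.
  set r : ℕ → ℝ → Vec n := fun k t => (ε k)⁻¹ • (dyn f (z k t) (u t) ω - dyn f (x t) (u t) ω -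
    dynJac f (x t) (u t) ω (z k t - x t)) with hr
  set s : ℕ → ℝ → Vec n := fun k t => (dyn f (z k t) (v t) ω - dyn f (x t) (v t) ω) -
    (dyn f (z k t) (u t) ω - dyn f (x t) (u t) ω) with hs
  set e : ℕ → ℝ → ℝ := fun k t => ‖r k t‖ + ‖s k t‖ with he
  have hrb : ∀ k, ∀ t ∈ Icc t₀ T, ‖r k t‖ ≤ 2 * D * c := by
    intro k t ht
    have h1 := hlip u huR t (z k t) (x t)
    have h2 := hJ t (z k t - x t)
    have h3 := mul_le_mul_of_nonneg_left (hzc k t ht) hD0.le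
    rw [hr]
    dsimp only
    rw [norm_smul, norm_inv, Real.norm_of_nonneg (hε k).le, inv_mul_le_iff₀ (hε k)]
    refine (norm_sub_le _ _).trans ?_
    linarith
  have hsb : ∀ k, ∀ t ∈ Icc t₀ T, ‖s k t‖ ≤ ε k * (2 * D * c) := by
    intro k t ht
    have h1 := hlip u huR t (z k t) (x t)
    have h2 := hlip v hvR t (z k t) (x t)
    have h3 := mul_le_mul_of_nonneg_left (hzc k t ht) hD0.le
    refine (norm_sub_le _ _).trans ?_
    linarith
  have hsb' : ∀ k, ∀ t ∈ Icc t₀ T, ‖s k t‖ ≤ 2 * D * c := fun k t ht =>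
    (hsb k t ht).trans (mul_le_of_le_one_left (by positivity) (hε1 k))
  have hem : ∀ k, Measurable (e k) := by
    intro k
    have h1 : ∀ {w : ℝ → Vec m} {a : ℝ → Vec n}, Measurable w → Measurable a →
        Measurable fun t => dyn f (a t) (w t) ω := fun hw ha =>
      hf.measurable_dyn ha hw measurable_const
    have h2 : Measurable fun t => dynJac f (x t) (u t) ω (z k t - x t) :=
      (isBoundedBilinearMap_apply (𝕜 := ℝ) (E := Vec n) (F := Vec n)).continuous.measurable.comp
        ((hf.measurable_dynJac hxm hu measurable_const).prodMk ((hzm k).sub hxm))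
    have h3 : Measurable fun t => dyn f (z k t) (u t) ω - dyn f (x t) (u t) ω :=
      (h1 hu (hzm k)).sub (h1 hu hxm)
    have h4 : Measurable fun t => dyn f (z k t) (v t) ω - dyn f (x t) (v t) ω :=
      (h1 hv (hzm k)).sub (h1 hv hxm)
    have hrm : Measurable (r k) := (h3.sub h2).const_smul (ε k)⁻¹
    have hsm : Measurable (s k) := h4.sub h3
    exact hrm.norm.add hsm.norm
  have heb : ∀ k, ∀ t ∈ Icc t₀ T, ‖e k t‖ ≤ 4 * D * c := by
    intro k t ht
    have h1 := hrb k t ht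
    have h2 := hsb' k t ht
    rw [Real.norm_of_nonneg (by positivity)]
    simp only [he]
    linarith
  have hIoc : ∀ t ∈ uIoc t₀ T, t ∈ Icc t₀ T := fun t ht => by
    rw [uIoc_of_le hT] at ht; exact ⟨ht.1.le, ht.2⟩
  have hei : ∀ k, IntervalIntegrable (e k) volume t₀ T := fun k =>
    IntervalIntegrable.mono_fun' (g := fun _ => 4 * D * c) (by simp)
      (hem k).aestronglyMeasurable
      ((ae_restrict_mem measurableSet_uIoc).mono fun t ht => heb k t (hIoc t ht))
  have hlim : Tendsto (fun k => ∫ t in t₀..T, e k t) atTop (𝓝 0) := by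
    have := intervalIntegral.tendsto_integral_filter_of_dominated_convergence (μ := volume)
      (a := t₀) (b := T) (F := e) (l := atTop) (f := fun _ => (0 : ℝ)) (fun _ => 4 * D * c)
      (Eventually.of_forall fun k => (hem k).aestronglyMeasurable)
      (Eventually.of_forall fun k => Eventually.of_forall fun t ht => heb k t (hIoc t ht))
      (by simp) ?_
    · simpa using this
    rw [ae_restrict_iff' measurableSet_Icc] at hd
    filter_upwards [hd] with t hdt ht
    have ht' := hIoc t ht
    have hzx : Tendsto (fun k => z k t) atTop (𝓝 (x t)) := by
      rw [tendsto_iff_norm_sub_tendsto_zero]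
      exact squeeze_zero (fun _ => norm_nonneg _) (fun k => hzc k t ht')
        (by simpa using hε0.mul_const c)
    have hs0 : Tendsto (fun k => ‖s k t‖) atTop (𝓝 0) :=
      squeeze_zero (fun _ => norm_nonneg _) (fun k => hsb k t ht')
        (by simpa using hε0.mul_const (2 * D * c))
    have hr0 : Tendsto (fun k => ‖r k t‖) atTop (𝓝 0) := by
      have hfd := (hdt ht').hasFDerivAt.isLittleO.comp_tendsto hzx
      have hO : (fun k => z k t - x t) =O[atTop] ε :=
        Asymptotics.IsBigO.of_bound c (Eventually.of_forall fun k => by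
          rw [Real.norm_of_nonneg (hε k).le, mul_comm]; exact hzc k t ht')
      have h1 := (hfd.trans_isBigO hO).tendsto_inv_smul_nhds_zero
      exact tendsto_zero_iff_norm_tendsto_zero.1 h1
    simpa using hr0.add hs0
  rw [tendsto_iff_norm_sub_tendsto_zero]
  refine squeeze_zero (fun _ => norm_nonneg _) (fun k => ?_)
    (by simpa using hlim.mul_const (Real.exp (D * (T - t₀))))
  have hw := ((((hz k).sub hx).const_smul (ε k)⁻¹).sub hy)
  have := hw.norm_le hD0.le (hei k) (fun t => by positivity) ?_ T ⟨hT, le_rfl⟩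
  · simpa [hz0 k, hy0] using this
  · refine Eventually.of_forall fun t => ?_
    -- Affinity in the control makes this identity exact: no remainder in the control direction
    -- appears, and Grönwall bounds the error by the integral of `e k`.
    have hid : (ε k)⁻¹ • (dyn f (z k t) (u t + ε k • (v t - u t)) ω - dyn f (x t) (u t) ω) -
        (dynJac f (x t) (u t) ω (y t) + (dyn f (x t) (v t) ω - dyn f (x t) (u t) ω)) =
        dynJac f (x t) (u t) ω ((ε k)⁻¹ • (z k t - x t) - y t) + (r k t + s k t) := by
      rw [dyn_convex_combination, hr, hs, map_sub, map_smul]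
      dsimp only
      simp only [smul_sub, smul_add, smul_smul, inv_mul_cancel₀ (hε k).ne', one_smul]
      abel
    rw [hid]
    refine (norm_add_le _ _).trans (add_le_add (hJ t _) (norm_add_le _ _))

end Trajectories

/-! ### The ensemble as an arc in `L²` -/

section Ensemble

variable {Ω : Type*} [MeasurableSpace Ω] {n m : ℕ} {f : Fin (m + 1) → Vec n → Ω → Vec n} {C R : ℝ}
  {t₀ T : ℝ} {μ : Measure Ω}

theorem IsLipDyn.isAdmissible_traj (hf : IsLipDyn f C) {U : ℝ → Set (Vec m)} (φ : Ω → Vec n)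
    {v : ℝ → Vec m} (hv : Measurable v) (hvR : ∀ t, ‖v t‖ ≤ R)
    (hvU : ∀ᵐ t ∂volume.restrict (Icc t₀ T), v t ∈ U t) :
    IsAdmissible f U φ t₀ T v fun t ω => traj f t₀ v (φ ω) t ω where
  control_memLp := memLp_top_of_bound hv.aestronglyMeasurable R (Eventually.of_forall hvR)
  control_mem := hvU
  init _ := hf.traj_self hv hvR _ _
  arc _ := hf.hasW11Deriv_traj hv hvR _ _

theorem IsLipDyn.memLp_traj [IsFiniteMeasure μ] (hf : IsLipDyn f C) {v : ℝ → Vec m}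
    (hv : Measurable v) (hvR : ∀ t, ‖v t‖ ≤ R) {φ : Ω → Vec n} (hφ : MemLp φ 2 μ) {t : ℝ}
    (ht : t ∈ Icc t₀ T) : MemLp (fun ω => traj f t₀ v (φ ω) t ω) 2 μ := by
  obtain ⟨B, hB0, hB⟩ := hf.exists_arc_bound ((norm_nonneg _).trans (hvR 0)) (ht.1.trans ht.2)
  obtain ⟨ψ, hψm, hψ⟩ := hφ.1.aemeasurable
  refine ((memLp_one_add_norm hφ).const_mul B).of_le ?_ (Eventually.of_forall fun ω => ?_)
  · have h0 : Measurable fun z : ℝ × Ω => traj f t₀ v (ψ z.2) z.1 z.2 :=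
      hf.measurable_traj hv hvR hψm
    have h1 : Measurable fun ω => traj f t₀ v (ψ ω) t ω :=
      Measurable.comp (g := fun z : ℝ × Ω => traj f t₀ v (ψ z.2) z.1 z.2) (f := fun ω => (t, ω)) h0
        measurable_prodMk_left
    refine (h1.aemeasurable.congr ?_).aestronglyMeasurable
    filter_upwards [hψ] with ω h
    rw [h]
  · have := hB v ω _ (Eventually.of_forall hvR) (hf.hasW11Deriv_traj hv hvR (φ ω) ω) t ht
    rw [hf.traj_self hv hvR] at this
    exact this.trans (le_abs_self _)

/-- Close controls have `W^{1,1}`-close ensemble trajectories. -/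
theorem IsLipDyn.exists_w11Norm_sub_traj_le [IsFiniteMeasure μ] [IsSeparable μ]
    (hf : IsLipDyn f C) (hR : 0 ≤ R) (hT : t₀ ≤ T) {φ : Ω → Vec n} (hφ : MemLp φ 2 μ) :
    ∃ Λ, ∀ (u v : ℝ → Vec m) (η : ℝ), Measurable u → Measurable v →
      (∀ t, ‖u t‖ ≤ R) → (∀ t, ‖v t‖ ≤ R) → (∀ t, ‖u t - v t‖ ≤ η) →
      ∃ d : ℝ → Lp (Vec n) 2 μ,
        HasW11Deriv t₀ T (fun t => toLpClass 2 μ (fun ω => traj f t₀ u (φ ω) t ω) -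
          toLpClass 2 μ (fun ω => traj f t₀ v (φ ω) t ω)) d ∧
        w11Norm t₀ T (fun t => toLpClass 2 μ (fun ω => traj f t₀ u (φ ω) t ω) -
          toLpClass 2 μ (fun ω => traj f t₀ v (φ ω) t ω)) d ≤ η * Λ := by
  obtain ⟨L, hL0, hL⟩ := hf.exists_arc_sub_bound hR hT
  have hφm := hφ.1.aemeasurable
  set w : Ω → ℝ := fun ω => L * (1 + ‖φ ω‖) with hw
  have hw2 : MemLp w 2 μ := (memLp_one_add_norm hφ).const_mul L
  have hw0 : ∀ ω, 0 ≤ w ω := fun ω => by positivity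
  refine ⟨2 * (‖toLpClass 2 μ w‖ * (T - t₀)), fun u v η hu hv huR hvR huv => ?_⟩
  -- `φ` is only almost everywhere measurable; joint measurability is obtained from a Borel version.
  set ψ := hφm.mk φ with hψ
  have hψm : Measurable ψ := hφm.measurable_mk
  have hψφ : ∀ᵐ ω ∂μ, φ ω = ψ ω := hφm.ae_eq_mk
  set Z : ℝ → Ω → Vec n := fun t ω => dyn f (traj f t₀ u (ψ ω) t ω) (u t) ω -
    dyn f (traj f t₀ v (ψ ω) t ω) (v t) ω with hZ
  set z : ℝ → Ω → Vec n := fun t ω => traj f t₀ u (φ ω) t ω - traj f t₀ v (φ ω) t ω with hz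
  have hbd : ∀ ω, ∀ t ∈ Icc t₀ T, ‖z t ω‖ ≤ η * w ω ∧
      ‖dyn f (traj f t₀ u (φ ω) t ω) (u t) ω - dyn f (traj f t₀ v (φ ω) t ω) (v t) ω‖ ≤
        η * w ω := fun ω t ht => by
    have := hL u v η ω _ _ huR hvR huv (hf.hasW11Deriv_traj hu huR (φ ω) ω)
      (hf.hasW11Deriv_traj hv hvR (φ ω) ω) (by rw [hf.traj_self hu huR, hf.traj_self hv hvR]) t ht
    rwa [hf.traj_self hu huR] at this
  have hZm : Measurable fun y : ℝ × Ω => Z y.1 y.2 :=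
    (hf.measurable_dyn (hf.measurable_traj hu huR hψm) (hu.comp measurable_fst)
      measurable_snd).sub (hf.measurable_dyn (hf.measurable_traj hv hvR hψm)
      (hv.comp measurable_fst) measurable_snd)
  have hZb : ∀ᵐ ω ∂μ, ∀ t ∈ Icc t₀ T, ‖Z t ω‖ ≤ η * w ω := by
    filter_upwards [hψφ] with ω hω t ht
    have := (hbd ω t ht).2
    rwa [hω] at this
  have hmu : ∀ t ∈ Icc t₀ T, MemLp (fun ω => traj f t₀ u (φ ω) t ω) 2 μ := fun t ht =>
    hf.memLp_traj hu huR hφ ht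
  have hmv : ∀ t ∈ Icc t₀ T, MemLp (fun ω => traj f t₀ v (φ ω) t ω) 2 μ := fun t ht =>
    hf.memLp_traj hv hvR hφ ht
  have ht₀ : t₀ ∈ Icc t₀ T := ⟨le_rfl, hT⟩
  obtain ⟨hzm, hzW⟩ := hasW11Deriv_toLpClass hT (z := z) (hw2.const_mul η) hZm hZb
    ((hmu t₀ ht₀).sub (hmv t₀ ht₀)) (by
      filter_upwards [hψφ] with ω hω t ht
      have := ((hf.hasW11Deriv_traj (T := T) hu huR (φ ω) ω).sub
        (hf.hasW11Deriv_traj hv hvR (φ ω) ω)).2 t ht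
      simp only [hz, hZ, ← hω]
      exact this)
  have hsub : ∀ t ∈ Icc t₀ T, toLpClass 2 μ (fun ω => traj f t₀ u (φ ω) t ω) -
      toLpClass 2 μ (fun ω => traj f t₀ v (φ ω) t ω) = toLpClass 2 μ (z t) := fun t ht =>
    toLpClass_sub (hmu t ht) (hmv t ht)
  refine ⟨fun t => toLpClass 2 μ (Z t), hzW.congr hT hsub (Eventually.of_forall fun _ => rfl), ?_⟩
  have hIcc : ∀ t ∈ uIoc t₀ T, t ∈ Icc t₀ T := fun t ht => by
    rw [uIoc_of_le hT] at ht; exact ⟨ht.1.le, ht.2⟩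
  have b1 := intervalIntegral.norm_integral_le_of_norm_le_const (a := t₀) (b := T)
    (f := fun t => ‖toLpClass 2 μ (fun ω => traj f t₀ u (φ ω) t ω) -
      toLpClass 2 μ (fun ω => traj f t₀ v (φ ω) t ω)‖) (C := η * ‖toLpClass 2 μ w‖)
    (fun t ht => by
      rw [norm_norm, hsub t (hIcc t ht)]
      refine norm_toLpClass_le hw2 (hzm t (hIcc t ht)).1 (Eventually.of_forall fun ω => ?_)
      rw [Real.norm_of_nonneg (hw0 ω)]
      exact (hbd ω t (hIcc t ht)).1)
  have b2 := intervalIntegral.norm_integral_le_of_norm_le_const (a := t₀) (b := T)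
    (f := fun t => ‖toLpClass 2 μ (Z t)‖) (C := η * ‖toLpClass 2 μ w‖)
    (fun t ht => by
      rw [norm_norm]
      refine norm_toLpClass_le hw2
        (hZm.comp (measurable_const.prodMk measurable_id)).aestronglyMeasurable ?_
      filter_upwards [hZb] with ω hω
      rw [Real.norm_of_nonneg (hw0 ω)]
      exact hω t (hIcc t ht))
  rw [abs_of_nonneg (sub_nonneg.2 hT)] at b1 b2
  have b1' := (le_abs_self _).trans b1
  have b2' := (le_abs_self _).trans b2
  rw [w11Norm]
  linarith

/-- The ensemble of solutions of the linearised equation. -/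
theorem IsLipDyn.exists_linearized [IsFiniteMeasure μ] [IsSeparable μ] (hf : IsLipDyn f C)
    (hT : t₀ ≤ T) {ψ : Ω → Vec n} (hψm : Measurable ψ) (hψ : MemLp ψ 2 μ) {u v : ℝ → Vec m}
    (hu : Measurable u) (hv : Measurable v) (huR : ∀ t, ‖u t‖ ≤ R) (hvR : ∀ t, ‖v t‖ ≤ R)
    {X : ℝ → Ω → Vec n} (hX : X = fun t ω => traj f t₀ u (ψ ω) t ω) :
    ∃ y : ℝ → Ω → Vec n, (∀ ω, y t₀ ω = 0) ∧ (∀ ω, HasW11Deriv t₀ T (fun t => y t ω) fun t =>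
        dynJac f (X t ω) (u t) ω (y t ω) + (dyn f (X t ω) (v t) ω - dyn f (X t ω) (u t) ω)) ∧
      MemLp (y T) 2 μ ∧
      HasW11Deriv t₀ T (fun t => toLpClass 2 μ (y t)) fun t =>
        linOp μ f (X t) (u t) (toLpClass 2 μ (y t)) +
          (dynL2 μ f (X t) (v t) - dynL2 μ f (X t) (u t)) := by
  have hR : 0 ≤ R := (norm_nonneg _).trans (huR 0)
  set D := C * (1 + m * R) with hD
  have hD0 : 0 < D := hf.rate_pos hR
  obtain ⟨B, hB0, hB⟩ := hf.exists_arc_bound hR hT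
  have hXm : Measurable fun z : ℝ × Ω => X z.1 z.2 := by
    rw [hX]; exact hf.measurable_traj hu huR hψm
  set W : Ω → ℝ := fun ω => 1 + ‖ψ ω‖ with hW
  have hW1 : ∀ ω, 1 ≤ W ω := fun ω => by simp [hW]
  have hXb : ∀ ω, ∀ t ∈ Icc t₀ T, ‖X t ω‖ ≤ B * W ω := fun ω t ht => by
    have := hB u ω _ (Eventually.of_forall huR) (hf.hasW11Deriv_traj hu huR (ψ ω) ω) t ht
    rw [hf.traj_self hu huR] at this
    rw [hX]; exact this
  -- Clamping time to the interval makes the growth bound on `X` available at all times, as the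
  -- Carathéodory hypotheses require.
  set P : ℝ → ℝ := fun t => (projIcc t₀ T hT t : ℝ) with hP
  have hPm : Measurable P := (continuous_subtype_val.comp continuous_projIcc).measurable
  have hPI : ∀ t, P t ∈ Icc t₀ T := fun t => (projIcc t₀ T hT t).2
  have hPt : ∀ t ∈ Icc t₀ T, P t = t := fun t ht => by simp [hP, projIcc_of_mem hT ht]
  set E : Ω → ℝ → Vec n := fun ω t => dyn f (X (P t) ω) (v t) ω - dyn f (X (P t) ω) (u t) ω with hE
  have hEb : ∀ ω t, ‖E ω t‖ ≤ 2 * D * (1 + B) * W ω := fun ω t => by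
    have h0 : 1 + ‖X (P t) ω‖ ≤ (1 + B) * W ω := by
      have := hXb ω (P t) (hPI t)
      have := hW1 ω
      linarith
    have h1 : ∀ a : Vec m, ‖a‖ ≤ R → ‖dyn f (X (P t) ω) a ω‖ ≤ D * ((1 + B) * W ω) :=
      fun a ha => (hf.dyn_growth _ a ω).trans (mul_le_mul (hf.mul_le ha) h0 (by positivity) hD0.le)
    refine (norm_sub_le _ _).trans ?_
    have := h1 (v t) (hvR t)
    have := h1 (u t) (huR t)
    linarith
  set F : Ω → ℝ → Vec n → Vec n := fun ω t ξ => dynJac f (X (P t) ω) (u t) ω ξ + E ω t with hF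
  have hXPm : Measurable fun z : ℝ × Ω => X (P z.1) z.2 :=
    hXm.comp ((hPm.comp measurable_fst).prodMk measurable_snd)
  have hJm : Measurable fun z : ℝ × Ω => dynJac f (X (P z.1) z.2) (u z.1) z.2 :=
    hf.measurable_dynJac hXPm (hu.comp measurable_fst) measurable_snd
  have hEm : Measurable fun z : ℝ × Ω => E z.2 z.1 :=
    (hf.measurable_dyn hXPm (hv.comp measurable_fst) measurable_snd).sub
      (hf.measurable_dyn hXPm (hu.comp measurable_fst) measurable_snd)
  have happly : Measurable fun z : (Vec n →L[ℝ] Vec n) × Vec n => z.1 z.2 :=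
    (isBoundedBilinearMap_apply (𝕜 := ℝ) (E := Vec n) (F := Vec n)).continuous.measurable
  have hFm : ∀ ξ, Measurable fun z : ℝ × Ω => F z.2 z.1 ξ := fun ξ =>
    (happly.comp (hJm.prodMk measurable_const)).add hEm
  have hJb : ∀ ω t (a : Vec n), ‖dynJac f (X (P t) ω) (u t) ω a‖ ≤ D * ‖a‖ := fun ω t a =>
    (dynJac f (X (P t) ω) (u t) ω).le_of_opNorm_le
      ((hf.norm_dynJac_le _ _ _).trans (hf.mul_le (huR t))) a
  -- The Lipschitz rate `D` is uniform in the parameter; only the bound at the origin grows with `W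
  -- ω`.
  have hFC : ∀ ω, IsCaratheodory (F ω) D (2 * D * (1 + B) * W ω) := fun ω =>
    { pos := hD0
      meas := fun ξ =>
        ((hFm ξ).comp (measurable_id.prodMk measurable_const)).stronglyMeasurable
      lip := fun t a b => by
        simp only [hF, add_sub_add_right_eq_sub, ← map_sub]
        exact hJb ω t (a - b)
      bound := fun t => by simpa [hF] using hEb ω t }
  set y : ℝ → Ω → Vec n := fun t ω => picardSol (F ω) t₀ 0 t with hy
  have hym : Measurable fun z : ℝ × Ω => y z.1 z.2 :=
    measurable_picardSol (y₀ := fun _ => 0) hFC hFm t₀ measurable_const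
  have hyW : ∀ ω, HasW11Deriv t₀ T (fun t => y t ω) fun t => F ω t (y t ω) := fun ω =>
    (hFC ω).hasW11Deriv_picardSol t₀ T 0
  have hy0 : ∀ ω, y t₀ ω = 0 := fun ω => (hFC ω).picardSol_self t₀ 0
  have hFe : ∀ ω, ∀ t ∈ Icc t₀ T, ∀ ξ, F ω t ξ = dynJac f (X t ω) (u t) ω ξ +
      (dyn f (X t ω) (v t) ω - dyn f (X t ω) (u t) ω) := fun ω t ht ξ => by
    simp only [hF, hE, hPt t ht]
  set M := 2 * D * (1 + B) with hM
  have hM0 : 0 ≤ M := by positivity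
  have hT' : 0 ≤ T - t₀ := sub_nonneg.2 hT
  set N := (T - t₀) * M * Real.exp (D * (T - t₀)) with hN
  have hyb : ∀ ω, ∀ t ∈ Icc t₀ T, ‖y t ω‖ ≤ N * W ω := fun ω t ht => by
    have hW0 : 0 ≤ W ω := zero_le_one.trans (hW1 ω)
    have := (hyW ω).norm_le hD0.le (e := fun _ => M * W ω) (by simp) (fun _ => by positivity)
      (Eventually.of_forall fun s => (norm_add_le _ _).trans (add_le_add (hJb ω s _) (hEb ω s)))
      t ht
    rw [hy0, norm_zero, zero_add, intervalIntegral.integral_const, smul_eq_mul] at this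
    refine this.trans_eq ?_
    rw [hN]; ring
  have hFyb : ∀ ω, ∀ t ∈ Icc t₀ T, ‖F ω t (y t ω)‖ ≤ (D * N + M) * W ω := fun ω t ht => by
    have h1 := mul_le_mul_of_nonneg_left (hyb ω t ht) hD0.le
    have h2 := (norm_add_le _ _).trans (add_le_add (hJb ω t (y t ω)) (hEb ω t))
    simp only [hF]
    linarith
  have hWm : MemLp W 2 μ := memLp_one_add_norm hψ
  obtain ⟨hymem, hyL⟩ := hasW11Deriv_toLpClass hT (z := y) (Z := fun t ω => F ω t (y t ω))
    (hWm.const_mul (D * N + M))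
    ((happly.comp (hJm.prodMk hym)).add hEm) (Eventually.of_forall hFyb)
    (by rw [show y t₀ = fun _ => 0 from funext hy0]; exact MemLp.zero')
    (Eventually.of_forall fun ω => (hyW ω).2)
  refine ⟨y, hy0, fun ω => (hyW ω).congr hT (fun _ _ => rfl) ?_, hymem T ⟨hT, le_rfl⟩,
    hyL.congr hT (fun _ _ => rfl) ?_⟩
  · filter_upwards [ae_restrict_mem measurableSet_Icc] with t ht
    rw [hFe ω t ht]
  · filter_upwards [ae_restrict_mem measurableSet_Icc] with t ht
    have hXt : MemLp (X t) 2 μ := by rw [hX]; exact hf.memLp_traj hu huR hψ ht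
    have h1 := hf.memLp_dyn hXt (v t)
    have h2 := hf.memLp_dyn hXt (u t)
    have hlin := hf.coeFn_linOp hXt.1.aemeasurable (u t) (toLpClass 2 μ (y t))
    have hyt := coeFn_toLpClass (hymem t ht)
    have hlin' : linOp μ f (X t) (u t) (toLpClass 2 μ (y t)) =ᵐ[μ]
        fun ω => dynJac f (X t ω) (u t) ω (y t ω) := by
      filter_upwards [hlin, hyt] with ω a b
      rw [a, b]
    have hmem : MemLp (fun ω => dynJac f (X t ω) (u t) ω (y t ω)) 2 μ :=
      (memLp_congr_ae hlin').1 (Lp.memLp _)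
    have e1 : linOp μ f (X t) (u t) (toLpClass 2 μ (y t)) =
        toLpClass 2 μ fun ω => dynJac f (X t ω) (u t) ω (y t ω) :=
      Lp.ext (hlin'.trans (coeFn_toLpClass hmem).symm)
    have hsub : MemLp (fun ω => dyn f (X t ω) (v t) ω - dyn f (X t ω) (u t) ω) 2 μ := h1.sub h2
    rw [e1, dynL2, dynL2, toLpClass_sub h1 h2, toLpClass_add hmem hsub]
    congr 1
    funext ω
    exact (hFe ω t ht _).symm

end Ensemble

/-! ### The first order condition -/

section FirstOrder

variable {Ω : Type*} [MeasurableSpace Ω] {n m : ℕ} {f : Fin (m + 1) → Vec n → Ω → Vec n}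
  {g : Vec n → Ω → ℝ} {U : ℝ → Set (Vec m)} {φ : Ω → Vec n} {C R : ℝ} {t₀ T : ℝ} {μ : Measure Ω}
  {u : ℝ → Vec m} {x : ℝ → Ω → Vec n}

theorem H0.continuous_cost (h0 : H0 f g U t₀ T) (ω : Ω) : Continuous fun z => g z ω := by
  obtain ⟨k, hk, h⟩ := h0.g_lipschitz
  refine (LipschitzWith.of_dist_le_mul (K := k.toNNReal) fun x y => ?_).continuous
  rw [Real.dist_eq, dist_eq_norm, Real.coe_toNNReal k (by linarith)]
  exact h x y ω

theorem H0.memLp_gradient [IsFiniteMeasure μ] (h0 : H0 f g U t₀ T) {y : Ω → Vec n}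
    (hy : AEMeasurable y μ) : MemLp (fun ω => gradient (fun z => g z ω) (y ω)) 2 μ := by
  obtain ⟨k, hk, h⟩ := h0.g_lipschitz
  refine MemLp.of_bound ?_ k (Eventually.of_forall fun ω => ?_)
  · have h1 : Measurable fun ω => gradient (fun z => g z ω) (hy.mk y ω) :=
      measurable_gradient_of_caratheodory h0.g_measurable h0.continuous_cost hy.measurable_mk
        measurable_id
    refine (h1.aemeasurable.congr ?_).aestronglyMeasurable
    filter_upwards [hy.ae_eq_mk] with ω hω
    rw [hω]
  · rw [gradient, LinearIsometryEquiv.norm_map]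
    exact norm_fderiv_le_of_lip' ℝ (by linarith) (Eventually.of_forall fun z => h z _ ω)

theorem H0.integrable_cost [IsFiniteMeasure μ] (h0 : H0 f g U t₀ T) {y : Ω → Vec n}
    (hy : AEMeasurable y μ) : Integrable (fun ω => g (y ω) ω) μ := by
  obtain ⟨M, -, h⟩ := h0.g_bounded
  exact Integrable.of_bound
    (h0.g_measurable.comp_aemeasurable (hy.prodMk aemeasurable_id)).aestronglyMeasurable M
    (Eventually.of_forall fun ω => h _ _)

/-- The linearised cost is nonnegative along convex variations of a local minimizer. -/
theorem IsW11LocalMinimizer.inner_gradient_nonneg [IsProbabilityMeasure μ] [IsSeparable μ]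
    (hmin : IsW11LocalMinimizer μ f g U φ t₀ T u x) (hT : t₀ ≤ T) (h0 : H0 f g U t₀ T)
    (hf : IsLipDyn f C) (hφ : MemLp φ 2 μ) {v w : ℝ → Vec m} (hv : Measurable v)
    (hvR : ∀ t, ‖v t‖ ≤ R) (huv : ∀ᵐ t ∂volume.restrict (Icc t₀ T), u t = v t)
    (hw : Measurable w) (hwR : ∀ t, ‖w t‖ ≤ R)
    (hwU : ∀ᵐ t ∂volume.restrict (Icc t₀ T), w t ∈ U t)
    (hdf : ∀ ω, ∀ᵐ t ∂volume.restrict (Icc t₀ T),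
      DifferentiableAt ℝ (fun ξ => dyn f ξ (u t) ω) (x t ω))
    (hdg : ∀ ω, DifferentiableAt ℝ (fun z => g z ω) (x T ω)) {y : ℝ → Ω → Vec n}
    (hy0 : ∀ ω, y t₀ ω = 0)
    (hy : ∀ᵐ ω ∂μ, HasW11Deriv t₀ T (fun t => y t ω) fun t =>
      dynJac f (traj f t₀ v (φ ω) t ω) (v t) ω (y t ω) +
        (dyn f (traj f t₀ v (φ ω) t ω) (w t) ω - dyn f (traj f t₀ v (φ ω) t ω) (v t) ω))
    (hyT : MemLp (y T) 2 μ) :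
    0 ≤ inner ℝ (toLpClass 2 μ fun ω => gradient (fun z => g z ω) (x T ω))
      (toLpClass 2 μ (y T)) := by
  obtain ⟨hadm, r, hr, hopt⟩ := hmin
  have hR : 0 ≤ R := (norm_nonneg _).trans (hvR 0)
  have hTI : T ∈ Icc t₀ T := ⟨hT, le_rfl⟩
  have hxX : ∀ ω, ∀ t ∈ Icc t₀ T, x t ω = traj f t₀ v (φ ω) t ω := fun ω t ht => by
    have := hf.eq_traj hv hvR (hadm.arc ω) huv t ht
    rwa [hadm.init] at this
  obtain ⟨kg, hkg, hglip⟩ := h0.g_lipschitz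
  obtain ⟨L, hL0, hL⟩ := hf.exists_arc_sub_bound hR hT
  obtain ⟨Λ, hΛ⟩ := hf.exists_w11Norm_sub_traj_le (μ := μ) hR hT hφ
  set ε : ℕ → ℝ := fun k => 1 / ((k : ℝ) + 1) with hε
  have hε0 : ∀ k, 0 < ε k := fun k => Nat.one_div_pos_of_nat
  have hε1 : ∀ k, ε k ≤ 1 := fun k => by
    rw [hε]; exact (div_le_one (by positivity)).2 (by linarith [Nat.cast_nonneg (α := ℝ) k])
  have hεlim : Tendsto ε atTop (𝓝 0) := tendsto_one_div_add_atTop_nhds_zero_nat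
  set c : ℕ → ℝ → Vec m := fun k t => v t + ε k • (w t - v t) with hc
  have hcm : ∀ k, Measurable (c k) := fun k => hv.add ((hw.sub hv).const_smul (ε k))
  have hcR : ∀ k t, ‖c k t‖ ≤ R := fun k t => by
    have h1 : v t ∈ Metric.closedBall (0 : Vec m) R := by simpa using hvR t
    have h2 : w t ∈ Metric.closedBall (0 : Vec m) R := by simpa using hwR t
    simpa using (convex_closedBall (0 : Vec m) R).add_smul_sub_mem h1 h2 ⟨(hε0 k).le, hε1 k⟩
  have hcU : ∀ k, ∀ᵐ t ∂volume.restrict (Icc t₀ T), c k t ∈ U t := fun k => by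
    filter_upwards [huv, hadm.control_mem, hwU, h0.U_convex] with t h1 h2 h3 h4
    exact h4.add_smul_sub_mem (h1 ▸ h2) h3 ⟨(hε0 k).le, hε1 k⟩
  have hvc : ∀ k t, ‖v t - c k t‖ ≤ ε k * (2 * R) := fun k t => by
    have : v t - c k t = -(ε k • (w t - v t)) := sub_add_cancel_left _ _
    rw [this, norm_neg, norm_smul, Real.norm_of_nonneg (hε0 k).le]
    refine mul_le_mul_of_nonneg_left ?_ (hε0 k).le
    have := norm_sub_le (w t) (v t)
    linarith [hvR t, hwR t]
  set z : ℕ → ℝ → Ω → Vec n := fun k t ω => traj f t₀ (c k) (φ ω) t ω with hz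
  have hzb : ∀ k ω, ∀ t ∈ Icc t₀ T,
      ‖z k t ω - traj f t₀ v (φ ω) t ω‖ ≤ ε k * (2 * R * (L * (1 + ‖φ ω‖))) := fun k ω t ht => by
    have := (hL v (c k) _ ω _ _ hvR (hcR k) (hvc k) (hf.hasW11Deriv_traj hv hvR (φ ω) ω)
      (hf.hasW11Deriv_traj (hcm k) (hcR k) (φ ω) ω)
      (by rw [hf.traj_self hv hvR, hf.traj_self (hcm k) (hcR k)]) t ht).1
    rw [hf.traj_self hv hvR, norm_sub_rev] at this
    exact this.trans_eq (by ring)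
  have hxTm : MemLp (x T) 2 μ := by
    rw [show x T = fun ω => traj f t₀ v (φ ω) T ω from funext fun ω => hxX ω T hTI]
    exact hf.memLp_traj hv hvR hφ hTI
  have hzTm : ∀ k, MemLp (z k T) 2 μ := fun k => hf.memLp_traj (hcm k) (hcR k) hφ hTI
  have hcost : ∀ᶠ k in atTop, ∫ ω, g (x T ω) ω ∂μ ≤ ∫ ω, g (z k T ω) ω ∂μ := by
    have hlim : Tendsto (fun k => ε k * (2 * R) * Λ) atTop (𝓝 0) := by
      simpa using (hεlim.mul_const (2 * R)).mul_const Λ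
    filter_upwards [hlim.eventually_le_const hr] with k hk
    obtain ⟨d, hd, hdn⟩ := hΛ v (c k) _ hv (hcm k) hvR (hcR k) (hvc k)
    have he : ∀ t ∈ Icc t₀ T, toLpClass 2 μ (x t) - toLpClass 2 μ (z k t) =
        toLpClass 2 μ (fun ω => traj f t₀ v (φ ω) t ω) - toLpClass 2 μ (z k t) := fun t ht => by
      rw [show x t = fun ω => traj f t₀ v (φ ω) t ω from funext fun ω => hxX ω t ht]
    refine hopt (c k) (z k) (hf.isAdmissible_traj φ (hcm k) (hcR k) (hcU k)) d
      (hd.congr hT he (Eventually.of_forall fun _ => rfl)) (le_trans (le_of_eq ?_) (hdn.trans hk))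
    rw [w11Norm, w11Norm]
    congr 1
    refine intervalIntegral.integral_congr fun t ht => ?_
    rw [uIcc_of_le hT] at ht
    rw [he t ht]
  have hptw : ∀ᵐ ω ∂μ, Tendsto (fun k => (ε k)⁻¹ • (g (z k T ω) ω - g (x T ω) ω)) atTop
      (𝓝 (inner ℝ (gradient (fun z => g z ω) (x T ω)) (y T ω))) := by
    filter_upwards [hy] with ω hyω
    have hvar := hf.tendsto_variation hT hv hw hvR hwR hε0 hεlim hε1
      (hf.continuous_traj hv hvR (φ ω) ω).measurable
      (fun k => (hf.continuous_traj (hcm k) (hcR k) (φ ω) ω).measurable)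
      (hf.hasW11Deriv_traj hv hvR (φ ω) ω)
      (fun k => hf.hasW11Deriv_traj (hcm k) (hcR k) (φ ω) ω)
      (fun k => by rw [hf.traj_self hv hvR, hf.traj_self (hcm k) (hcR k)])
      (fun k t ht => hzb k ω t ht) hyω (hy0 ω)
      (by
        filter_upwards [hdf ω, huv, ae_restrict_mem measurableSet_Icc] with t h1 h2 h3
        rwa [h2, hxX ω t h3] at h1)
    rw [← hxX ω T hTI] at hvar
    have hdlim : Tendsto (fun k => z k T ω - x T ω) atTop (𝓝 0) := by
      rw [tendsto_zero_iff_norm_tendsto_zero]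
      refine squeeze_zero (fun _ => norm_nonneg _) (fun k => ?_)
        (by simpa using hεlim.mul_const (2 * R * (L * (1 + ‖φ ω‖))))
      rw [hxX ω T hTI]
      exact hzb k ω T hTI
    -- The increments of the final state, divided by `ε k`, converge to `y T ω`, so the cost
    -- quotients converge to the derivative of `g` in that direction.
    have := (hasFDerivWithinAt_univ.2 (hdg ω).hasFDerivAt).lim hdlim
      (Eventually.of_forall fun _ => mem_univ _) hvar
    simp only [add_sub_cancel] at this
    rw [gradient, InnerProductSpace.toDual_symm_apply]
    exact this
  have hint : Tendsto (fun k => ∫ ω, (ε k)⁻¹ • (g (z k T ω) ω - g (x T ω) ω) ∂μ) atTop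
      (𝓝 (∫ ω, inner ℝ (gradient (fun z => g z ω) (x T ω)) (y T ω) ∂μ)) := by
    -- The uniform Lipschitz constant of `g` and the `O(ε)` bound on final states give a majorant
    -- independent of `k`.
    refine tendsto_integral_of_dominated_convergence
      (fun ω => kg * (2 * R * L) * (1 + ‖φ ω‖)) (fun k => ?_) ?_ (fun k => ?_) hptw
    · exact (((h0.integrable_cost (hzTm k).1.aemeasurable).sub
        (h0.integrable_cost hxTm.1.aemeasurable)).smul (ε k)⁻¹).aestronglyMeasurable
    · exact ((memLp_one_add_norm hφ).integrable (by norm_num)).const_mul _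
    · refine Eventually.of_forall fun ω => ?_
      rw [norm_smul, norm_inv, Real.norm_of_nonneg (hε0 k).le, inv_mul_le_iff₀ (hε0 k)]
      refine (hglip _ _ _).trans ?_
      have h1 := hzb k ω T hTI
      rw [← hxX ω T hTI] at h1
      have h2 := mul_le_mul_of_nonneg_left h1 (show 0 ≤ kg by linarith)
      exact h2.trans_eq (by ring)
  have hfin : 0 ≤ ∫ ω, inner ℝ (gradient (fun z => g z ω) (x T ω)) (y T ω) ∂μ := by
    refine ge_of_tendsto hint ?_
    filter_upwards [hcost] with k hk
    rw [integral_smul, integral_sub (h0.integrable_cost (hzTm k).1.aemeasurable)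
      (h0.integrable_cost hxTm.1.aemeasurable)]
    exact smul_nonneg (inv_nonneg.2 (hε0 k).le) (sub_nonneg.2 hk)
  rw [inner_toLpClass _ hyT]
  refine hfin.trans_eq (integral_congr_ae ?_)
  filter_upwards [coeFn_toLpClass (h0.memLp_gradient hxTm.1.aemeasurable)] with ω hω
  rw [hω]

/-- The maximum condition in integrated form. -/
theorem IsW11LocalMinimizer.integral_inner_le_zero [IsProbabilityMeasure μ] [IsSeparable μ]
    (hmin : IsW11LocalMinimizer μ f g U φ t₀ T u x) (hT : t₀ ≤ T) (h0 : H0 f g U t₀ T)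
    (hf : IsLipDyn f C) (hφ : MemLp φ 2 μ) {v w : ℝ → Vec m} (hv : Measurable v)
    (hvR : ∀ t, ‖v t‖ ≤ R) (huv : ∀ᵐ t ∂volume.restrict (Icc t₀ T), u t = v t)
    (hw : Measurable w) (hwR : ∀ t, ‖w t‖ ≤ R)
    (hwU : ∀ᵐ t ∂volume.restrict (Icc t₀ T), w t ∈ U t)
    (hdf : ∀ ω, ∀ᵐ t ∂volume.restrict (Icc t₀ T),
      DifferentiableAt ℝ (fun ξ => dyn f ξ (u t) ω) (x t ω))
    (hdg : ∀ ω, DifferentiableAt ℝ (fun z => g z ω) (x T ω)) {p : ℝ → Lp (Vec n) 2 μ}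
    (hp : HasW11Deriv t₀ T p
      fun t => -(ContinuousLinearMap.adjoint (linOp μ f (x t) (u t))) (p t))
    (hpT : -p T = toLpClass 2 μ fun ω => gradient (fun z => g z ω) (x T ω)) :
    ∫ t in t₀..T, inner ℝ (p t) (dynL2 μ f (x t) (w t) - dynL2 μ f (x t) (u t)) ≤ 0 := by
  have hadm := hmin.1
  obtain ⟨ψ, hψm, hψφ⟩ := hφ.1.aemeasurable
  have hψ : MemLp ψ 2 μ := (memLp_congr_ae hψφ).1 hφ
  obtain ⟨y, hy0, hyW, hyT, hyL⟩ := hf.exists_linearized hT hψm hψ hv hw hvR hwR rfl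
  have hnn := hmin.inner_gradient_nonneg hT h0 hf hφ hv hvR huv hw hwR hwU hdf hdg hy0
    (by filter_upwards [hψφ] with ω hω; rw [hω]; exact hyW ω) hyT
  have hxX : ∀ t ∈ Icc t₀ T, x t =ᵐ[μ] fun ω => traj f t₀ v (ψ ω) t ω := fun t ht => by
    filter_upwards [hψφ] with ω hω
    have := hf.eq_traj hv hvR (hadm.arc ω) huv t ht
    rwa [hadm.init, hω] at this
  have hyL' : HasW11Deriv t₀ T (fun t => toLpClass 2 μ (y t)) fun t =>
      linOp μ f (x t) (u t) (toLpClass 2 μ (y t)) +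
        (dynL2 μ f (x t) (w t) - dynL2 μ f (x t) (u t)) := by
    refine hyL.congr hT (fun _ _ => rfl) ?_
    filter_upwards [huv, ae_restrict_mem measurableSet_Icc] with t h1 h2
    rw [h1, linOp_congr f (hxX t h2), dynL2_congr f (hxX t h2), dynL2_congr f (hxX t h2)]
  have hprod := hp.inner_sub_inner hT hyL'
  have hyt₀ : toLpClass 2 μ (y t₀) = 0 := by
    rw [show y t₀ = 0 from funext hy0, toLpClass_zero]
  -- The two terms with the linearised operator cancel. What remains equates the integral with `⟨p
  -- T, y T⟩`, the negative of the linearised cost.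
  simp only [inner_neg_left, ContinuousLinearMap.adjoint_inner_left, inner_add_right,
    neg_add_cancel_left, hyt₀, inner_zero_right, sub_zero] at hprod
  rw [← hprod]
  rw [← hpT, inner_neg_left] at hnn
  linarith

end FirstOrder

/-! ### The pointwise maximum condition -/

/-- An integrated inequality over all measurable selections holds pointwise almost everywhere. -/
theorem ae_forall_sum_mul_le_zero {m : ℕ} {a b R : ℝ} {U : ℝ → Set (Vec m)} {u : ℝ → Vec m}
    {h : Fin m → ℝ → ℝ}
    (hgraph : MeasurableSet
      {z : NullMeasurableSpace ℝ (volume : Measure ℝ) × Vec m | z.1 ∈ Icc a b ∧ z.2 ∈ U z.1})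
    (hUR : ∀ t ∈ Icc a b, ∀ v ∈ U t, ‖v‖ ≤ R) (hu : Measurable u)
    (huU : ∀ᵐ t ∂volume.restrict (Icc a b), u t ∈ U t)
    (hh : ∀ i, Integrable (h i) (volume.restrict (Icc a b)))
    (hsel : ∀ w : ℝ → Vec m, Measurable w → (∀ᵐ t ∂volume.restrict (Icc a b), w t ∈ U t) →
      ∫ t in Icc a b, ∑ i, (w t - u t) i * h i t ≤ 0) :
    ∀ᵐ t ∂volume.restrict (Icc a b), ∀ v ∈ U t, ∑ i, (v - u t) i * h i t ≤ 0 := by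
  obtain ⟨B, hB, hBg⟩ := exists_measurableSet_of_nullMeasurable_prod hgraph
  choose k hkm hhk using fun i => (hh i).1.aemeasurable
  set E : Set (ℝ × Vec m) := B ∩ {z | 0 < ∑ i, (z.2 - u z.1) i * k i z.1} with hE
  have hEm : MeasurableSet E := by
    refine hB.inter (measurableSet_lt measurable_const (Finset.measurable_sum _ fun i _ => ?_))
    have h1 : Measurable fun z : ℝ × Vec m => z.2 - u z.1 :=
      measurable_snd.sub (hu.comp measurable_fst)
    have h2 : Measurable fun v : Vec m => v i := by fun_prop
    exact (h2.comp h1).mul ((hkm i).comp measurable_fst)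
  have hhk' : ∀ᵐ t ∂volume.restrict (Icc a b), ∀ i, h i t = k i t := ae_all_iff.2 hhk
  have hBg' : ∀ᵐ t ∂volume.restrict (Icc a b), ∀ v, v ∈ U t ↔ (t, v) ∈ B := by
    filter_upwards [ae_restrict_of_ae hBg, ae_restrict_mem measurableSet_Icc] with t h1 h2 v
    exact ⟨fun hv => (h1 v).1 ⟨h2, hv⟩, fun hv => ((h1 v).2 hv).2⟩
  -- The projection of the violating set `E` need not be Borel, so `volume` acts here as an outer
  -- measure.
  by_cases hnull : volume (Prod.fst '' E) = 0
  · have hnot : ∀ᵐ t ∂volume.restrict (Icc a b), t ∉ Prod.fst '' E :=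
      ae_restrict_of_ae (measure_eq_zero_iff_ae_notMem.1 hnull)
    filter_upwards [hhk', hBg', hnot] with t h1 h2 h3 v hv
    by_contra hpos
    rw [not_le] at hpos
    refine h3 ⟨(t, v), ⟨(h2 v).1 hv, ?_⟩, rfl⟩
    simpa only [mem_ofPred_eq, h1] using hpos
  exfalso
  obtain ⟨S, v, hS, hS0, hv, hvE⟩ := exists_measurable_section hEm hnull
  classical
  -- Following the violating section on `S` and `u` elsewhere makes the integrand nonnegative, and
  -- positive almost everywhere on `S`.
  set w : ℝ → Vec m := S.piecewise v u with hw
  have hwm : Measurable w := hv.piecewise hS.measurableSet hu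
  have hwU : ∀ᵐ t ∂volume.restrict (Icc a b), w t ∈ U t := by
    filter_upwards [hBg', huU] with t h1 h2
    by_cases ht : t ∈ S
    · rw [hw, piecewise_eq_of_mem _ _ _ ht]; exact (h1 _).2 (hvE t ht).1
    · rw [hw, piecewise_eq_of_notMem _ _ _ ht]; exact h2
  have hint := hsel w hwm hwU
  set F : ℝ → ℝ := fun t => ∑ i, (w t - u t) i * h i t with hF
  have hFi : Integrable F (volume.restrict (Icc a b)) := by
    refine integrable_finsetSum _ fun i _ => ?_
    have hm : Measurable fun t => (w t - u t) i := by
      have h2 : Measurable fun v : Vec m => v i := by fun_prop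
      exact h2.comp (hwm.sub hu)
    refine (hh i).bdd_mul (c := R + R) hm.aestronglyMeasurable ?_
    filter_upwards [hwU, huU, ae_restrict_mem measurableSet_Icc] with t h1 h2 h3
    refine (abs_coord_le_norm (w t - u t) i).trans ((norm_sub_le _ _).trans ?_)
    exact add_le_add (hUR t h3 _ h1) (hUR t h3 _ h2)
  have hFS : ∀ᵐ t ∂volume.restrict (Icc a b), 0 ≤ F t ∧ (t ∈ S → 0 < F t) := by
    filter_upwards [hhk'] with t h1
    by_cases ht : t ∈ S
    · have h2 := (hvE t ht).2
      have h3 : 0 < F t := by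
        simp only [hF, hw, piecewise_eq_of_mem _ _ _ ht, h1]
        exact h2
      exact ⟨h3.le, fun _ => h3⟩
    · have : F t = 0 := by simp [hF, hw, piecewise_eq_of_notMem _ _ _ ht]
      exact ⟨this.ge, fun h => absurd h ht⟩
  have hF0 : F =ᵐ[volume.restrict (Icc a b)] 0 := by
    have hnn : 0 ≤ᵐ[volume.restrict (Icc a b)] F := hFS.mono fun t ht => ht.1
    exact (integral_eq_zero_iff_of_nonneg_ae hnn hFi).1
      (le_antisymm hint (integral_nonneg_of_ae hnn))
  have hSn : ∀ᵐ t, t ∉ S := by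
    have h1 := (ae_restrict_iff' measurableSet_Icc).1 (hFS.and hF0)
    filter_upwards [h1, hBg] with t h2 h3 ht
    have htI : t ∈ Icc a b := ((h3 (v t)).2 (hvE t ht).1).1
    obtain ⟨h4, h5⟩ := h2 htI
    exact (h4.2 ht).ne' h5
  exact hS0 (measure_eq_zero_iff_ae_notMem.2 hSn)

theorem toLpClass_sum_smul {Ω F ι : Type*} [MeasurableSpace Ω] [NormedAddCommGroup F]
    [NormedSpace ℝ F] {p : ℝ≥0∞} {μ : Measure Ω} (s : Finset ι) (c : ι → ℝ) {φ : ι → Ω → F}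
    (hφ : ∀ i, MemLp (φ i) p μ) :
    toLpClass p μ (fun ω => ∑ i ∈ s, c i • φ i ω) = ∑ i ∈ s, c i • toLpClass p μ (φ i) := by
  classical
  induction s using Finset.induction_on with
  | empty =>
    simp only [Finset.sum_empty]
    exact toLpClass_zero
  | insert i s hi ih =>
    have h1 : MemLp (fun ω => c i • φ i ω) p μ := (hφ i).const_smul (c i)
    have h2 : MemLp (fun ω => ∑ j ∈ s, c j • φ j ω) p μ :=
      memLp_finsetSum s fun j _ => (hφ j).const_smul (c j)
    have h3 : toLpClass p μ (fun ω => c i • φ i ω) = c i • toLpClass p μ (φ i) := by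
      rw [toLpClass_of_memLp h1, toLpClass_of_memLp (hφ i)]
      exact MemLp.toLp_const_smul _ _
    simp only [Finset.sum_insert hi]
    rw [← toLpClass_add h1 h2, ih, h3]

section Maximum

variable {Ω : Type*} [MeasurableSpace Ω] {n m : ℕ} {f : Fin (m + 1) → Vec n → Ω → Vec n}
  {g : Vec n → Ω → ℝ} {U : ℝ → Set (Vec m)} {φ : Ω → Vec n} {C : ℝ} {t₀ T : ℝ} {μ : Measure Ω}
  {u : ℝ → Vec m} {x : ℝ → Ω → Vec n}

/-- Separates control from time: along an arc, only `m` scalar functions of `t` enter the maximum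
condition, so one exceptional null set serves all control values. -/
theorem IsLipDyn.inner_dynL2_sub [IsFiniteMeasure μ] (hf : IsLipDyn f C) {y : Ω → Vec n}
    (hy : MemLp y 2 μ) (v w : Vec m) (p : Lp (Vec n) 2 μ) :
    inner ℝ p (dynL2 μ f y v - dynL2 μ f y w) =
      ∑ i, (v - w) i * inner ℝ p (toLpClass 2 μ fun ω => f i.succ (y ω) ω) := by
  rw [dynL2, dynL2, toLpClass_sub (hf.memLp_dyn hy v) (hf.memLp_dyn hy w)]
  simp only [dyn_sub_control]
  rw [toLpClass_sum_smul Finset.univ (fun i => (v - w) i) fun i => hf.memLp_field i.succ hy,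
    inner_sum]
  simp only [inner_smul_right]

/-- Along an admissible arc, the vector fields are integrable against continuous curves. -/
theorem IsLipDyn.integrable_inner_field [IsFiniteMeasure μ] [IsSeparable μ] (hf : IsLipDyn f C)
    (hT : t₀ ≤ T) (hφ : MemLp φ 2 μ) {R : ℝ} {v : ℝ → Vec m} (hv : Measurable v)
    (hvR : ∀ t, ‖v t‖ ≤ R) {p : ℝ → Lp (Vec n) 2 μ} (hp : ContinuousOn p (Icc t₀ T))
    (hx : ∀ ω, ∀ t ∈ Icc t₀ T, x t ω = traj f t₀ v (φ ω) t ω) (i : Fin (m + 1)) :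
    Integrable (fun t => inner ℝ (p t) (toLpClass 2 μ fun ω => f i (x t ω) ω))
      (volume.restrict (Icc t₀ T)) := by
  obtain ⟨ψ, hψm, hψφ⟩ := hφ.1.aemeasurable
  have hψ : MemLp ψ 2 μ := (memLp_congr_ae hψφ).1 hφ
  obtain ⟨B, hB0, hB⟩ := hf.exists_arc_bound (T := T) ((norm_nonneg _).trans (hvR 0)) hT
  obtain ⟨N, hN⟩ := isCompact_Icc.exists_bound_of_continuousOn hp
  have hC := hf.pos
  set P : ℝ → ℝ := fun t => (projIcc t₀ T hT t : ℝ) with hP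
  have hPm : Measurable P := (continuous_subtype_val.comp continuous_projIcc).measurable
  have hPI : ∀ t, P t ∈ Icc t₀ T := fun t => (projIcc t₀ T hT t).2
  have hPt : ∀ t ∈ Icc t₀ T, P t = t := fun t ht => by simp [hP, projIcc_of_mem hT ht]
  obtain ⟨X, hXm, hXI, hXB, hXx⟩ : ∃ X : ℝ → Ω → Vec n, (Measurable fun z : ℝ × Ω => X z.1 z.2) ∧
      (∀ t ∈ Icc t₀ T, MemLp (X t) 2 μ) ∧
      (∀ ω, ∀ t ∈ Icc t₀ T, ‖X t ω‖ ≤ B * (1 + ‖ψ ω‖)) ∧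
      ∀ᵐ ω ∂μ, ∀ t ∈ Icc t₀ T, x t ω = X t ω := by
    refine ⟨fun t ω => traj f t₀ v (ψ ω) t ω, hf.measurable_traj hv hvR hψm,
      fun t ht => hf.memLp_traj hv hvR hψ ht, fun ω t ht => ?_, ?_⟩
    · have h1 := hB v ω _ (Eventually.of_forall hvR) (hf.hasW11Deriv_traj hv hvR (ψ ω) ω) t ht
      rwa [hf.traj_self hv hvR] at h1
    · filter_upwards [hψφ] with ω hω t ht
      rw [hx ω t ht, hω]
  have hXPm : Measurable fun z : ℝ × Ω => X (P z.1) z.2 :=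
    hXm.comp ((hPm.comp measurable_fst).prodMk measurable_snd)
  have hX2 : ∀ t, MemLp (X (P t)) 2 μ := fun t => hXI (P t) (hPI t)
  have hsm : StronglyMeasurable fun t => toLpClass 2 μ fun ω => f i (X (P t) ω) ω :=
    stronglyMeasurable_toLpClass (hf.measurable_comp i hXPm measurable_snd)
      fun t => hf.memLp_field i (hX2 t)
  have hxX : ∀ t ∈ Icc t₀ T, toLpClass 2 μ (fun ω => f i (x t ω) ω) =
      toLpClass 2 μ fun ω => f i (X (P t) ω) ω := fun t ht => by
    refine toLpClass_congr ?_
    filter_upwards [hXx] with ω hω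
    rw [hω t ht, hPt t ht]
  set W : Ω → ℝ := fun ω => 1 + ‖ψ ω‖ with hW
  have hW2 : MemLp W 2 μ := memLp_one_add_norm hψ
  have hFb : ∀ t, ‖toLpClass 2 μ fun ω => f i (X (P t) ω) ω‖ ≤
      C * (1 + B) * ‖toLpClass 2 μ W‖ := fun t => by
    refine norm_toLpClass_le hW2 (hf.memLp_field i (hX2 t)).1 (Eventually.of_forall fun ω => ?_)
    have hW1 : 1 ≤ W ω := by simp [hW]
    rw [Real.norm_of_nonneg (by linarith), mul_assoc]
    refine (hf.growth i _ ω).trans (mul_le_mul_of_nonneg_left ?_ hC.le)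
    have h2 : ‖X (P t) ω‖ ≤ B * W ω := hXB ω _ (hPI t)
    linarith
  have hmeas : AEStronglyMeasurable
      (fun t => (inner ℝ (p t) (toLpClass 2 μ fun ω => f i (x t ω) ω) : ℝ))
      (volume.restrict (Icc t₀ T)) := by
    refine ((hp.aestronglyMeasurable measurableSet_Icc).inner
      hsm.aestronglyMeasurable).congr ?_
    filter_upwards [ae_restrict_mem measurableSet_Icc] with t ht
    rw [hxX t ht]
  refine Integrable.of_bound hmeas (N * (C * (1 + B) * ‖toLpClass 2 μ W‖)) ?_
  filter_upwards [ae_restrict_mem measurableSet_Icc] with t ht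
  rw [hxX t ht]
  have hN0 := (norm_nonneg _).trans (hN t ht)
  exact (norm_inner_le_norm _ _).trans (mul_le_mul (hN t ht) (hFb t) (norm_nonneg _) hN0)

/-- The maximum condition along a local minimizer. -/
theorem IsW11LocalMinimizer.ae_isGreatest [IsProbabilityMeasure μ] [IsSeparable μ]
    (hmin : IsW11LocalMinimizer μ f g U φ t₀ T u x) (hT : t₀ ≤ T) (h0 : H0 f g U t₀ T)
    (hf : IsLipDyn f C) (hUC : ∀ t ∈ Icc t₀ T, ∀ v ∈ U t, ‖v‖ ≤ C) (hφ : MemLp φ 2 μ)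
    (hdf : ∀ ω, ∀ᵐ t ∂volume.restrict (Icc t₀ T),
      DifferentiableAt ℝ (fun ξ => dyn f ξ (u t) ω) (x t ω))
    (hdg : ∀ ω, DifferentiableAt ℝ (fun z => g z ω) (x T ω)) {p : ℝ → Lp (Vec n) 2 μ}
    (hp : HasW11Deriv t₀ T p
      fun t => -(ContinuousLinearMap.adjoint (linOp μ f (x t) (u t))) (p t))
    (hpT : -p T = toLpClass 2 μ fun ω => gradient (fun z => g z ω) (x T ω)) :
    ∀ᵐ t ∂volume.restrict (Icc t₀ T),
      IsGreatest ((fun v : Vec m => inner ℝ (p t) (dynL2 μ f (x t) v)) '' U t)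
        (inner ℝ (p t) (dynL2 μ f (x t) (u t))) := by
  have hadm := hmin.1
  have hC := hf.pos
  obtain ⟨v, hv, hvR, huv⟩ := exists_measurable_control hC.le hUC hadm.control_memLp.1
    hadm.control_mem
  have hx : ∀ ω, ∀ t ∈ Icc t₀ T, x t ω = traj f t₀ v (φ ω) t ω := fun ω t ht => by
    have := hf.eq_traj hv hvR (hadm.arc ω) huv t ht
    rwa [hadm.init] at this
  have hx2 : ∀ t ∈ Icc t₀ T, MemLp (x t) 2 μ := fun t ht => by
    rw [show x t = fun ω => traj f t₀ v (φ ω) t ω from funext fun ω => hx ω t ht]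
    exact hf.memLp_traj hv hvR hφ ht
  have key := ae_forall_sum_mul_le_zero h0.U_graph hUC hv
    (by filter_upwards [huv, hadm.control_mem] with t h1 h2; rwa [← h1])
    (fun i : Fin m => hf.integrable_inner_field hT hφ hv hvR hp.continuousOn hx i.succ)
    (fun w hw hwU => by
      obtain ⟨c, hc, hcR, hwc⟩ := exists_measurable_control hC.le hUC hw.aestronglyMeasurable hwU
      have := hmin.integral_inner_le_zero hT h0 hf hφ hv hvR huv hc hcR
        (by filter_upwards [hwc, hwU] with t h1 h2; rwa [← h1]) hdf hdg hp hpT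
      rw [intervalIntegral.integral_of_le hT, ← integral_Icc_eq_integral_Ioc] at this
      refine le_trans (le_of_eq (integral_congr_ae ?_)) this
      filter_upwards [huv, hwc, ae_restrict_mem measurableSet_Icc] with t h1 h2 h3
      rw [hf.inner_dynL2_sub (hx2 t h3), h1, h2])
  filter_upwards [key, huv, hadm.control_mem, ae_restrict_mem measurableSet_Icc] with t h1 h2 h3 h4
  refine ⟨⟨u t, h3, rfl⟩, ?_⟩
  rintro _ ⟨w, hw, rfl⟩
  have := h1 w hw
  rw [← h2, ← hf.inner_dynL2_sub (hx2 t h4), inner_sub_right] at this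
  linarith

end Maximum

end EnsemblePMP

/-! ### The maximum principle -/

open EnsemblePMP in
theorem mainTheorem1 {Ω : Type*} [MetricSpace Ω] [CompleteSpace Ω]
    [TopologicalSpace.SeparableSpace Ω] [MeasurableSpace Ω] [BorelSpace Ω]
    (μ : MeasureTheory.Measure Ω) [MeasureTheory.IsProbabilityMeasure μ]
    {n m : ℕ} (t₀ T : ℝ) (ht : t₀ < T)
    (f : Fin (m + 1) → Vec n → Ω → Vec n) (g : Vec n → Ω → ℝ) (U : ℝ → Set (Vec m))
    (φ : Ω → Vec n) (hφ : MeasureTheory.MemLp φ 2 μ)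
    (u : ℝ → Vec m) (x : ℝ → Ω → Vec n) (δ : ℝ) (hδ : 0 < δ)
    (h0 : H0 f g U t₀ T)
    (hmin : IsW11LocalMinimizer μ f g U φ t₀ T u x)
    (h1 : H1 μ f g U t₀ T x δ) :
    -- all the objects of the statement are well defined
    (∀ t ∈ Set.Icc t₀ T, MeasureTheory.MemLp (x t) 2 μ ∧
      (∀ v : Vec m, MeasureTheory.MemLp (fun ω => dyn f (x t ω) v ω) 2 μ) ∧
      MeasureTheory.MemLp (fun ω => dynJac f (x t ω) (u t) ω) ⊤ μ) ∧
    MeasureTheory.MemLp (fun ω => gradient (fun z => g z ω) (x T ω)) 2 μ ∧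
    (∃ G, IsEvolutionOperator (fun s => linOp μ f (x s) (u s)) t₀ T G) ∧
    -- the maximum principle
    ∀ G, IsEvolutionOperator (fun s => linOp μ f (x s) (u s)) t₀ T G →
      ∀ q : MeasureTheory.Lp (Vec n) 2 μ,
        q = toLpClass 2 μ (fun ω => gradient (fun z => g z ω) (x T ω)) →
      ∀ p : ℝ → MeasureTheory.Lp (Vec n) 2 μ,
        (∀ t ∈ Set.Icc t₀ T, p t = -(ContinuousLinearMap.adjoint (G T t)) q) →
        -- `p ∈ W^{1,1}` is the solution of the backward problem
        HasW11Deriv t₀ T p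
          (fun t => -(ContinuousLinearMap.adjoint (linOp μ f (x t) (u t))) (p t)) ∧
        -p T = q ∧
        (∀ p' : ℝ → MeasureTheory.Lp (Vec n) 2 μ,
          HasW11Deriv t₀ T p'
            (fun t => -(ContinuousLinearMap.adjoint (linOp μ f (x t) (u t))) (p' t)) →
          -p' T = q → Set.EqOn p' p (Set.Icc t₀ T)) ∧
        -- the maximum condition
        ∀ᵐ t ∂(MeasureTheory.volume.restrict (Set.Icc t₀ T)),
          IsGreatest ((fun v : Vec m => inner ℝ (p t) (dynL2 μ f (x t) v)) '' U t)
            (inner ℝ (p t) (dynL2 μ f (x t) (u t))) := by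
  obtain ⟨C, hf, hUC⟩ := h0.exists_isLipDyn
  have hT : t₀ ≤ T := ht.le
  have hTI : T ∈ Icc t₀ T := ⟨hT, le_rfl⟩
  have hadm := hmin.1
  obtain ⟨v, hv, hvR, huv⟩ := exists_measurable_control hf.pos.le hUC hadm.control_memLp.1
    hadm.control_mem
  have hx : ∀ ω, ∀ t ∈ Icc t₀ T, x t ω = traj f t₀ v (φ ω) t ω := fun ω t ht => by
    have := hf.eq_traj hv hvR (hadm.arc ω) huv t ht
    rwa [hadm.init] at this
  have hx2 : ∀ t ∈ Icc t₀ T, MemLp (x t) 2 μ := fun t ht => by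
    rw [show x t = fun ω => traj f t₀ v (φ ω) t ω from funext fun ω => hx ω t ht]
    exact hf.memLp_traj hv hvR hφ ht
  obtain ⟨ψ, hψm, hψφ⟩ := hφ.1.aemeasurable
  have hA : IsBoundedField (fun t => linOp μ f (x t) (u t)) t₀ T := by
    refine hf.isBoundedField_linOp (z := fun t ω => traj f t₀ v (ψ ω) t ω)
      (hf.measurable_traj hv hvR hψm) hv hvR (fun t ht => ?_) huv
    filter_upwards [hψφ] with ω hω
    rw [hx ω t ht, hω]
  have hdf : ∀ ω, ∀ᵐ t ∂volume.restrict (Icc t₀ T),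
      DifferentiableAt ℝ (fun ξ => dyn f ξ (u t) ω) (x t ω) := fun ω => by
    filter_upwards [h1.f_contDiff ω, hadm.control_mem] with t h2 h3
    exact ((h2 (u t) h3).contDiffAt (Metric.ball_mem_nhds _ hδ)).differentiableAt one_ne_zero
  have hdg : ∀ ω, DifferentiableAt ℝ (fun z => g z ω) (x T ω) := fun ω =>
    h1.g_diff ω _ (Metric.mem_ball_self hδ)
  refine ⟨fun t ht => ⟨hx2 t ht, fun w => hf.memLp_dyn (hx2 t ht) w,
    hf.memLp_dynJac (hx2 t ht).1.aemeasurable (u t)⟩,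
    h0.memLp_gradient (hx2 T hTI).1.aemeasurable, exists_isEvolutionOperator hA, ?_⟩
  rintro G hG q rfl p hp
  -- The backward solution is built independently of `G`. Duality shows it equals `p` on the
  -- interval, which transfers the `W^{1,1}` regularity to `p`.
  obtain ⟨p₁, hp₁, hp₁T⟩ := exists_backward_solution hT hA
    (-toLpClass 2 μ fun ω => gradient (fun z => g z ω) (x T ω))
  have hpp₁ : ∀ t ∈ Icc t₀ T, p t = p₁ t := fun t ht => by
    rw [hp t ht, hp₁.eq_adjoint_apply hG ht, hp₁T, map_neg]
  have hpW : HasW11Deriv t₀ T p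
      fun t => -(ContinuousLinearMap.adjoint (linOp μ f (x t) (u t))) (p t) := by
    refine hp₁.congr hT hpp₁ ?_
    filter_upwards [ae_restrict_mem measurableSet_Icc] with t ht
    rw [hpp₁ t ht]
  have hpT : -p T = toLpClass 2 μ fun ω => gradient (fun z => g z ω) (x T ω) := by
    rw [hpp₁ T hTI, hp₁T, neg_neg]
  refine ⟨hpW, hpT, fun p' hp' hp'T t ht => ?_,
    hmin.ae_isGreatest hT h0 hf hUC hφ hdf hdg hpW hpT⟩
  rw [hp t ht, hp'.eq_adjoint_apply hG ht, ← hp'T, map_neg, neg_neg]
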